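/- Let $p\ge 0$ be an integer and let $\pi:\mathbb R^p\to[0,\infty)$ be a log-concave probability density with respect to Lebesgue measure, i.e. $\int\pi=1$ and $\pi(x)^a\pi(y)^b\le\pi(ax+by)$ for all $x,y\in\mathbb R^p$ and all $a,b\ge0$ with $a+b=1$. For real $k>0$ let $\mu_k=\mu_k(\pi)=\mathbf E_{\vartheta\sim\pi}[\|\vartheta\|_2^k]$ denote its (uncentered) moments. Let $\Gamma(k,x)=\int_x^\infty t^{k-1}e^{-t}\,dt$ be the upper incomplete Gamma function. For every real $k>2$, the moments $\mu_2$ and $\mu_k$ are finite and $$\mu_k\le A_k\,\mu_2^{k/2},\qquad A_k=\min_{\lambda>2,\ \gamma>1}A_k(\lambda,\gamma),$$ where $$A_k(\lambda,\gamma)=\frac{\sqrt{\lambda-1}}{\lambda}\left[\frac{2\sqrt\lambda}{\log(\lambda-1)}\right]^k k\,\Gamma\!\left(k,\frac{\gamma^{1/2}\log(\lambda-1)}{2}\right)+\frac{k(\gamma\lambda)^{k/2-1}-2}{k-2},$$ and this minimum is attained for every real $k>2$. Numerically, $A_3\le 40.40$ and $A_4\le 441.43$. -/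

import Mathlib

open MeasureTheory

noncomputable section

/-- `π` is a probability density on `ℝ^p` with respect to Lebesgue measure. -/
structure IsProbDensity {p : ℕ} (π : EuclideanSpace ℝ (Fin p) → ℝ) : Prop where
  nonneg : ∀ x, 0 ≤ π x
  integrable : Integrable π volume
  integral_eq_one : ∫ x, π x = 1

/-- Log-concavity of a nonnegative function on `ℝ^p`, in multiplicative form, so that the function
may vanish (its potential `-log π` is a convex function with values in `(-∞, +∞]`). -/
def IsLogConcave {p : ℕ} (π : EuclideanSpace ℝ (Fin p) → ℝ) : Prop :=
  (∀ x, 0 ≤ π x) ∧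
    ∀ x y : EuclideanSpace ℝ (Fin p), ∀ a b : ℝ, 0 ≤ a → 0 ≤ b → a + b = 1 →
      π x ^ a * π y ^ b ≤ π (a • x + b • y)

/-- The distribution on `ℝ^p` with Lebesgue density `π`. -/
def law {p : ℕ} (π : EuclideanSpace ℝ (Fin p) → ℝ) : Measure (EuclideanSpace ℝ (Fin p)) :=
  volume.withDensity fun x => ENNReal.ofReal (π x)

/-- The moment `μ_k(π) = E_{ϑ ∼ π} ‖ϑ‖₂ ^ k`, for a real exponent `k`. -/
def moment {p : ℕ} (π : EuclideanSpace ℝ (Fin p) → ℝ) (k : ℝ) : ℝ :=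
  ∫ x, ‖x‖ ^ k ∂(law π)

/-- The upper incomplete Gamma function `Γ(s, x) = ∫_x^∞ t^(s-1) e^(-t) dt`. -/
def upperGamma (s x : ℝ) : ℝ :=
  ∫ t in Set.Ioi x, t ^ (s - 1) * Real.exp (-t)

/-- The two-parameter expression `A_k(lam, gam)`. -/
def momentConstAt (k lam gam : ℝ) : ℝ :=
  Real.sqrt (lam - 1) / lam * (2 * Real.sqrt lam / Real.log (lam - 1)) ^ k * k *
      upperGamma k (gam ^ (1 / 2 : ℝ) * Real.log (lam - 1) / 2)
    + (k * (gam * lam) ^ (k / 2 - 1) - 2) / (k - 2)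

/-- The values of `A_k(lam, gam)` over `lam > 2`, `gam > 1`. -/
def momentConstValues (k : ℝ) : Set ℝ :=
  {a | ∃ lam gam : ℝ, 2 < lam ∧ 1 < gam ∧ a = momentConstAt k lam gam}

/-- The constant `A_k`, the infimum of `A_k(lam, gam)` over `lam > 2`, `gam > 1`. -/
def momentConst (k : ℝ) : ℝ := sInf (momentConstValues k)

end

/-! Tails of a log-concave law decay exponentially on the scale fixed by its second moment. With σ²
= μ_2, Chebyshev gives mass at most 1/λ outside the ball of radius √λ σ. Borell's lemma
(`IsLogConcave.law_norm_gt_le`) upgrades this to an exponential bound at all larger radii. It rests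
on the Prékopa-Leindler inequality, proved here from one-dimensional Brunn-Minkowski by induction on
dimension.

For Y = ‖ϑ‖/σ, the layer-cake integral of k s^(k-1) P(Y > s) is cut at 1 and at √(γλ), and P(Y > s)
is bounded by 1, by 1/s² and by the exponential tail on the three pieces. The first two pieces give
the power term of A_k(λ, γ), the third the incomplete Gamma term
(`lintegral_rpow_le_of_unit_second_moment`, `IsLogConcave.moment_le`).

For attainment, sublevel sets of A_k(λ, γ) on λ > 2, γ ≥ 1 lie in a compact box, so a minimiser
exists there. It must have γ > 1: from a point (λ, 1), raising γ lowers the value if log(λ-1) < 4,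
and lowering λ with γλ fixed does so if log(λ-1) ≥ 4. The numerical bounds evaluate A_k at explicit
parameters. -/

section

open Set Filter Topology
open scoped ENNReal Pointwise

/-! ### Brunn-Minkowski and Prékopa-Leindler on the line -/

/-- The one-dimensional Brunn-Minkowski inequality for compact sets. -/
theorem volume_add_le_of_isCompact {K L C : Set ℝ} (hK : IsCompact K) (hL : IsCompact L)
    (hK0 : K.Nonempty) (hL0 : L.Nonempty) (h : ∀ x ∈ K, ∀ y ∈ L, x + y ∈ C) :
    volume K + volume L ≤ volume C := by
  set s := sSup K
  set i := sInf L
  have hsK : s ∈ K := hK.sSup_mem hK0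
  have hiL : i ∈ L := hL.sInf_mem hL0
  -- The translates K + inf L and sup K + L both lie in K + L and can meet only at sup K + inf L.
  have hdisj : AEDisjoint volume ((fun x => x + i) '' K) ((fun y => s + y) '' L) := by
    refine measure_mono_null (t := {s + i}) ?_ (by simp)
    rintro z ⟨⟨x, hx, rfl⟩, ⟨y, hy, hxy⟩⟩
    have h1 : x ≤ s := le_csSup hK.bddAbove hx
    have h2 : i ≤ y := csInf_le hL.bddBelow hy
    simp only at hxy
    simp only [mem_singleton_iff]
    linarith
  have hsub : (fun x => x + i) '' K ∪ (fun y => s + y) '' L ⊆ C := by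
    rintro z (⟨x, hx, rfl⟩ | ⟨y, hy, rfl⟩)
    · exact h x hx i hiL
    · exact h s hsK y hy
  have hm : MeasurableSet ((fun y => s + y) '' L) :=
    (hL.image (by fun_prop)).measurableSet
  calc volume K + volume L
      = volume ((fun x => x + i) '' K) + volume ((fun y => s + y) '' L) := by simp
    _ = volume ((fun x => x + i) '' K ∪ (fun y => s + y) '' L) :=
        (measure_union₀ hm.nullMeasurableSet hdisj).symm
    _ ≤ volume C := measure_mono hsub

theorem exists_isCompact_nonempty_lt {A : Set ℝ} (hA : MeasurableSet A)
    {r : ℝ≥0∞} (hr : r < volume A) :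
    ∃ K ⊆ A, IsCompact K ∧ K.Nonempty ∧ r < volume K := by
  obtain ⟨K, hKA, hK, hrK⟩ := hA.exists_lt_isCompact hr
  exact ⟨K, hKA, hK, nonempty_of_measure_ne_zero (hrK.trans_le' bot_le).ne', hrK⟩

/-- The one-dimensional Brunn-Minkowski inequality. -/
theorem volume_add_le {A B C : Set ℝ} (hA : MeasurableSet A) (hB : MeasurableSet B)
    (hA0 : A.Nonempty) (hB0 : B.Nonempty) (h : ∀ x ∈ A, ∀ y ∈ B, x + y ∈ C) :
    volume A + volume B ≤ volume C := by
  have key : ∀ {A : Set ℝ}, MeasurableSet A → ∀ c : ℝ≥0∞,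
      (∀ K ⊆ A, IsCompact K → K.Nonempty → volume K ≤ c) → volume A ≤ c := by
    intro A hA c hc
    refine le_of_forall_lt fun r hr => ?_
    obtain ⟨K, h1, h2, h3, h4⟩ := exists_isCompact_nonempty_lt hA hr
    exact h4.trans_le (hc K h1 h2 h3)
  by_cases hC : volume C = ∞
  · simp [hC]
  have h1 : ∀ K ⊆ A, IsCompact K → K.Nonempty → volume B ≤ volume C - volume K := by
    intro K hKA hK hK0
    refine key hB _ fun L hLB hL hL0 => ?_
    refine ENNReal.le_sub_of_add_le_left hK.measure_lt_top.ne ?_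
    exact volume_add_le_of_isCompact hK hL hK0 hL0 fun x hx y hy => h x (hKA hx) y (hLB hy)
  -- Taking K to be a single point of A shows that B has finite measure, which makes subtracting it
  -- in `ℝ≥0∞` harmless.
  have hBtop : volume B ≠ ∞ := by
    obtain ⟨x, hx⟩ := hA0
    refine ne_top_of_le_ne_top hC ?_
    simpa using h1 {x} (by simpa using hx) isCompact_singleton (singleton_nonempty x)
  have h2 : volume A ≤ volume C - volume B := by
    refine key hA _ fun K hKA hK hK0 => ?_
    refine ENNReal.le_sub_of_add_le_right hBtop ?_
    have hKC : volume K ≤ volume C := by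
      obtain ⟨y, hy⟩ := hB0
      have := volume_add_le_of_isCompact (C := C) hK (isCompact_singleton (x := y)) hK0
        (singleton_nonempty y) fun x hx z hz => by rw [mem_singleton_iff.1 hz]; exact h x (hKA hx) y hy
      simpa using this
    calc volume K + volume B ≤ volume K + (volume C - volume K) := by
          gcongr; exact h1 K hKA hK hK0
      _ = volume C := add_tsub_cancel_of_le hKC
  have hBC : volume B ≤ volume C := by
    obtain ⟨x, hx⟩ := hA0
    simpa using h1 {x} (by simpa using hx) isCompact_singleton (singleton_nonempty x)
  calc volume A + volume B ≤ (volume C - volume B) + volume B := by gcongr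
    _ = volume C := tsub_add_cancel_of_le hBC

theorem volume_smul_add_smul_le {A B C : Set ℝ} (hA : MeasurableSet A) (hB : MeasurableSet B)
    (hA0 : A.Nonempty) (hB0 : B.Nonempty) {a b : ℝ} (ha : 0 < a) (hb : 0 < b)
    (h : ∀ x ∈ A, ∀ y ∈ B, a * x + b * y ∈ C) :
    ENNReal.ofReal a * volume A + ENNReal.ofReal b * volume B ≤ volume C := by
  have := volume_add_le (C := C) (hA.const_smul₀ a) (hB.const_smul₀ b) (hA0.smul_set (a := a))
    (hB0.smul_set (a := b)) (by
      rintro _ ⟨x, hx, rfl⟩ _ ⟨y, hy, rfl⟩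
      exact h x hx y hy)
  simpa [Measure.addHaar_smul, abs_of_pos ha, abs_of_pos hb] using this

/-- Layer cake, with levels t ≥ 1 discarded because their superlevel sets are empty. Brunn-Minkowski
needs nonempty sets, which normalisation guarantees only for t < 1. -/
theorem lintegral_ofReal_eq_Ioo {α : Type*} [MeasurableSpace α] {μ : Measure α} {f : α → ℝ}
    (hf : Measurable f) (hf0 : ∀ x, 0 ≤ f x) (hf1 : ∀ x, f x ≤ 1) :
    ∫⁻ x, ENNReal.ofReal (f x) ∂μ = ∫⁻ t in Ioo (0 : ℝ) 1, μ {x | t < f x} := by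
  rw [lintegral_eq_lintegral_meas_lt μ (Eventually.of_forall hf0) hf.aemeasurable,
    ← Ioo_union_Ici_eq_Ioi (zero_lt_one' ℝ),
    lintegral_union measurableSet_Ici
      (Set.disjoint_left.2 fun x hx hx' => (hx.2.trans_le hx').false)]
  have : ∫⁻ t in Ici (1 : ℝ), μ {x | t < f x} = 0 := by
    rw [setLIntegral_congr_fun measurableSet_Ici (g := fun _ => 0)]
    · simp
    · intro t ht
      have : {x | t < f x} = ∅ := by
        ext x
        simpa using (hf1 x).trans ht
      simp [this]
  rw [this, add_zero]

/-- Prékopa-Leindler on the line, for functions with essential range reaching up to `1`. -/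
theorem prekopaLeindler_real_of_normalized {f g : ℝ → ℝ} {h : ℝ → ℝ≥0∞} (hf : Measurable f)
    (hg : Measurable g) (hh : Measurable h) (hf0 : ∀ x, 0 ≤ f x) (hf1 : ∀ x, f x ≤ 1)
    (hg0 : ∀ x, 0 ≤ g x) (hg1 : ∀ x, g x ≤ 1) (hfs : ∀ t < 1, ∃ x, t < f x)
    (hgs : ∀ t < 1, ∃ x, t < g x) {a b : ℝ} (ha : 0 < a) (hb : 0 < b)
    (H : ∀ x y, ENNReal.ofReal (min (f x) (g y)) ≤ h (a * x + b * y)) :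
    ENNReal.ofReal a * (∫⁻ x, ENNReal.ofReal (f x)) +
      ENNReal.ofReal b * (∫⁻ x, ENNReal.ofReal (g x)) ≤ ∫⁻ x, h x := by
  -- Truncating h at 1 loses nothing at the levels t < 1 that matter, and makes it real-valued.
  have htop : ∀ x, min (h x) 1 ≠ ∞ := fun x => ((min_le_right _ _).trans_lt ENNReal.one_lt_top).ne
  have hk : ∫⁻ x, ENNReal.ofReal (min (h x) 1).toReal ≤ ∫⁻ x, h x := by
    refine lintegral_mono fun x => ?_
    rw [ENNReal.ofReal_toReal (htop x)]
    exact min_le_left _ _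
  refine le_trans ?_ hk
  rw [lintegral_ofReal_eq_Ioo hf hf0 hf1, lintegral_ofReal_eq_Ioo hg hg0 hg1,
    lintegral_ofReal_eq_Ioo (hh.min measurable_const).ennreal_toReal
      (fun x => ENNReal.toReal_nonneg) (fun x => by
        simpa using ENNReal.toReal_mono ENNReal.one_ne_top (min_le_right (h x) 1))]
  have hanti : ∀ u : ℝ → ℝ, Measurable fun t : ℝ => volume {x | t < u x} := fun u =>
    Antitone.measurable fun s t hst => measure_mono fun x (hx : t < u x) => hst.trans_lt hx
  rw [← lintegral_const_mul _ (hanti f), ← lintegral_const_mul _ (hanti g),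
    ← lintegral_add_left ((hanti f).const_mul _)]
  -- At each level, a{f > t} + b{g > t} is contained in the superlevel set of the truncated h.
  refine setLIntegral_mono' measurableSet_Ioo fun t ht => ?_
  refine volume_smul_add_smul_le (measurableSet_lt measurable_const hf)
    (measurableSet_lt measurable_const hg) (hfs t ht.2) (hgs t ht.2) ha hb ?_
  intro x hx y hy
  have h1 : ENNReal.ofReal (min (f x) (g y)) ≤ min (h (a * x + b * y)) 1 :=
    le_min (H x y) (by simpa using Or.inl (hf1 x))
  have h2 := ENNReal.toReal_mono (htop _) h1
  rw [ENNReal.toReal_ofReal (le_min (hf0 x) (hg0 y))] at h2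
  exact (lt_min hx hy).trans_le h2

/-- Weighted AM-GM: it converts the additive inequality for normalised functions into the
multiplicative one. -/
theorem ENNReal.rpow_mul_rpow_le_add {a b : ℝ} (ha : 0 < a) (hb : 0 < b) (hab : a + b = 1)
    (u v : ℝ≥0∞) : u ^ a * v ^ b ≤ ENNReal.ofReal a * u + ENNReal.ofReal b * v := by
  by_cases hu : u = ∞
  · simp [hu, ENNReal.mul_top, ha]
  by_cases hv : v = ∞
  · simp [hv, ENNReal.mul_top, hb]
  lift u to NNReal using hu
  lift v to NNReal using hv
  have := NNReal.geom_mean_le_arith_mean2_weighted (Real.toNNReal a) (Real.toNNReal b) u v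
    (by rw [← Real.toNNReal_add ha.le hb.le, hab, Real.toNNReal_one])
  rw [Real.coe_toNNReal _ ha.le, Real.coe_toNNReal _ hb.le] at this
  rw [← ENNReal.coe_rpow_of_nonneg _ ha.le, ← ENNReal.coe_rpow_of_nonneg _ hb.le]
  unfold ENNReal.ofReal
  exact_mod_cast this

/-- Prékopa-Leindler on the line for bounded functions. -/
theorem prekopaLeindler_real_of_le {f g h : ℝ → ℝ≥0∞} (hf : Measurable f)
    (hg : Measurable g) (hh : Measurable h) {c : ℝ≥0∞} (hc : c ≠ ∞) (hfc : ∀ x, f x ≤ c)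
    (hgc : ∀ x, g x ≤ c) {a b : ℝ} (ha : 0 < a) (hb : 0 < b) (hab : a + b = 1)
    (H : ∀ x y, f x ^ a * g y ^ b ≤ h (a * x + b * y)) :
    (∫⁻ x, f x) ^ a * (∫⁻ x, g x) ^ b ≤ ∫⁻ x, h x := by
  -- Dividing f and g by their suprema, and h by M^a N^b, keeps the hypothesis and reaches the
  -- normalised case.
  set M := ⨆ x, f x with hM
  set N := ⨆ x, g x with hN
  have hMt : M ≠ ∞ := ne_top_of_le_ne_top hc (iSup_le hfc)
  have hNt : N ≠ ∞ := ne_top_of_le_ne_top hc (iSup_le hgc)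
  have hfM : ∀ x, f x ≤ M := le_iSup f
  have hgN : ∀ x, g x ≤ N := le_iSup g
  by_cases hM0 : M = 0
  · have : ∀ x, f x = 0 := fun x => le_antisymm (hM0 ▸ hfM x) bot_le
    simp [this, ENNReal.zero_rpow_of_pos ha]
  by_cases hN0 : N = 0
  · have : ∀ x, g x = 0 := fun x => le_antisymm (hN0 ▸ hgN x) bot_le
    simp [this, ENNReal.zero_rpow_of_pos hb]
  have aux : ∀ {u : ℝ → ℝ≥0∞} {M : ℝ≥0∞}, M ≠ 0 → M ≠ ∞ → (∀ x, u x ≤ M) → M = ⨆ x, u x →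
      (∀ x, u x / M ≠ ∞) ∧ (∀ x, (u x / M).toReal ≤ 1) ∧ ∀ t < 1, ∃ x, t < (u x / M).toReal := by
    intro u M hM0 hMt huM hM
    have h1 : ∀ x, u x / M ≠ ∞ := fun x =>
      ENNReal.div_ne_top (ne_top_of_le_ne_top hMt (huM x)) hM0
    refine ⟨h1, fun x => ?_, fun t ht => ?_⟩
    · have : u x / M ≤ 1 := ENNReal.div_le_of_le_mul (by simpa using huM x)
      simpa using ENNReal.toReal_mono ENNReal.one_ne_top this
    · have : ENNReal.ofReal t * M < ⨆ x, u x := by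
        rw [← hM]
        calc ENNReal.ofReal t * M < 1 * M := by
              rw [ENNReal.mul_lt_mul_iff_left hM0 hMt]
              simpa using ht
          _ = M := one_mul M
      obtain ⟨x, hx⟩ := lt_iSup_iff.1 this
      refine ⟨x, ?_⟩
      have h2 : ENNReal.ofReal t < u x / M := by
        rwa [ENNReal.lt_div_iff_mul_lt (Or.inl hM0) (Or.inl hMt)]
      rcases lt_or_ge t 0 with ht0 | ht0
      · exact ht0.trans_le ENNReal.toReal_nonneg
      · exact (ENNReal.ofReal_lt_iff_lt_toReal ht0 (h1 x)).1 h2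
  obtain ⟨hf1, hf2, hf3⟩ := aux hM0 hMt hfM hM
  obtain ⟨hg1, hg2, hg3⟩ := aux hN0 hNt hgN hN
  set D := M ^ a * N ^ b with hD
  have hMa : M ^ a ≠ 0 := by simp [ENNReal.rpow_eq_zero_iff, hM0, hMt]
  have hMa' : M ^ a ≠ ∞ := ENNReal.rpow_ne_top_of_nonneg ha.le hMt
  have hNb : N ^ b ≠ 0 := by simp [ENNReal.rpow_eq_zero_iff, hN0, hNt]
  have hNb' : N ^ b ≠ ∞ := ENNReal.rpow_ne_top_of_nonneg hb.le hNt
  have hD0 : D ≠ 0 := mul_ne_zero hMa hNb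
  have hDt : D ≠ ∞ := ENNReal.mul_ne_top hMa' hNb'
  have hsplit : ∀ u v : ℝ≥0∞, (u / M) ^ a * (v / N) ^ b = u ^ a * v ^ b / D := by
    intro u v
    rw [ENNReal.div_rpow_of_nonneg _ _ ha.le, ENNReal.div_rpow_of_nonneg _ _ hb.le, hD,
      div_eq_mul_inv, div_eq_mul_inv, div_eq_mul_inv,
      ENNReal.mul_inv (Or.inl hMa) (Or.inl hMa')]
    ring
  have key := prekopaLeindler_real_of_normalized (f := fun x => (f x / M).toReal)
    (g := fun x => (g x / N).toReal) (h := fun x => h x / D)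
    (hf.div_const _).ennreal_toReal (hg.div_const _).ennreal_toReal (hh.div_const _)
    (fun x => ENNReal.toReal_nonneg) hf2 (fun x => ENNReal.toReal_nonneg) hg2 hf3 hg3 ha hb (by
      intro x y
      refine le_trans ?_ (ENNReal.div_le_div_right (H x y) D)
      rw [← hsplit, ENNReal.ofReal_min, ENNReal.ofReal_toReal (hf1 x), ENNReal.ofReal_toReal (hg1 y)]
      set m := min (f x / M) (g y / N)
      by_cases hm : m = 0
      · simp [hm]
      have hmt : m ≠ ∞ := ne_top_of_le_ne_top (hf1 x) (min_le_left _ _)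
      -- The minimum is at most the weighted geometric mean, since a + b = 1.
      calc m = m ^ a * m ^ b := by rw [← ENNReal.rpow_add _ _ hm hmt, hab, ENNReal.rpow_one]
        _ ≤ _ := by
          gcongr
          · exact min_le_left _ _
          · exact min_le_right _ _)
  simp only [ENNReal.ofReal_toReal (hf1 _), ENNReal.ofReal_toReal (hg1 _)] at key
  simp only [div_eq_mul_inv] at key
  rw [lintegral_mul_const _ hf, lintegral_mul_const _ hg, lintegral_mul_const _ hh] at key
  simp only [← div_eq_mul_inv] at key
  have h2 := (ENNReal.rpow_mul_rpow_le_add ha hb hab _ _).trans key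
  rw [hsplit] at h2
  simpa [ENNReal.div_mul_cancel hD0 hDt] using mul_le_mul_left h2 D

/-- The Prékopa-Leindler inequality on the line. -/
theorem prekopaLeindler_real {f g h : ℝ → ℝ≥0∞} (hf : Measurable f)
    (hg : Measurable g) (hh : Measurable h) {a b : ℝ} (ha : 0 < a) (hb : 0 < b) (hab : a + b = 1)
    (H : ∀ x y, f x ^ a * g y ^ b ≤ h (a * x + b * y)) :
    (∫⁻ x, f x) ^ a * (∫⁻ x, g x) ^ b ≤ ∫⁻ x, h x := by
  have hlim : ∀ {u : ℝ → ℝ≥0∞}, Measurable u →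
      (∫⁻ x, u x) = ⨆ n : ℕ, ∫⁻ x, min (u x) n := by
    intro u hu
    rw [← lintegral_iSup (fun n => hu.min measurable_const)
      (fun n m hnm x => min_le_min_left _ (by exact_mod_cast hnm))]
    congr 1 with x
    rw [← inf_iSup_eq, ENNReal.iSup_natCast, inf_top_eq]
  have hmono : ∀ u : ℝ → ℝ≥0∞, Monotone fun n : ℕ => ∫⁻ x, min (u x) n := fun u n m hnm =>
    lintegral_mono fun x => min_le_min_left _ (by exact_mod_cast hnm)
  have hpow : ∀ {s : ℝ} (_ : 0 < s) (v : ℕ → ℝ≥0∞), (⨆ n, v n) ^ s = ⨆ n, v n ^ s := by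
    intro s hs v
    exact (ENNReal.orderIsoRpow s hs).map_iSup v
  rw [hlim hf, hlim hg, hpow ha, hpow hb, ENNReal.iSup_mul]
  refine iSup_le fun n => ?_
  rw [ENNReal.mul_iSup]
  refine iSup_le fun m => ?_
  refine le_trans (mul_le_mul' (ENNReal.rpow_le_rpow (hmono f (le_max_left n m)) ha.le)
    (ENNReal.rpow_le_rpow (hmono g (le_max_right n m)) hb.le)) ?_
  refine prekopaLeindler_real_of_le (hf.min measurable_const) (hg.min measurable_const) hh
    (ENNReal.natCast_ne_top _) (fun x => min_le_right _ _) (fun x => min_le_right _ _) ha hb hab ?_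
  intro x y
  refine le_trans ?_ (H x y)
  gcongr <;> exact min_le_left _ _

/-! ### Prékopa-Leindler in higher dimensions -/

/-- The Prékopa-Leindler inequality on `ℝⁿ`. -/
theorem prekopaLeindler_pi {a b : ℝ} (ha : 0 < a) (hb : 0 < b) (hab : a + b = 1) :
    ∀ (n : ℕ) {f g h : (Fin n → ℝ) → ℝ≥0∞}, Measurable f → Measurable g → Measurable h →
      (∀ x y, f x ^ a * g y ^ b ≤ h (a • x + b • y)) →
      (∫⁻ x, f x) ^ a * (∫⁻ x, g x) ^ b ≤ ∫⁻ x, h x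
  | 0, f, g, h, hf, hg, hh, H => by
    simp only [volume_pi, Measure.pi_of_empty (fun _ : Fin 0 => (volume : Measure ℝ)) 0,
      lintegral_dirac' _ hf, lintegral_dirac' _ hg, lintegral_dirac' _ hh]
    simpa using H 0 0
  | n + 1, f, g, h, hf, hg, hh, H => by
    -- One coordinate is split off by Tonelli. The induction hypothesis on the slices says exactly
    -- that the slice integrals satisfy the one-dimensional assumption.
    set e := (MeasurableEquiv.piFinSuccAbove (fun _ : Fin (n + 1) => ℝ) 0).symm with he
    have hpres : MeasurePreserving e :=
      (volume_preserving_piFinSuccAbove (fun _ : Fin (n + 1) => ℝ) 0).symm _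
    have hint : ∀ {u : (Fin (n + 1) → ℝ) → ℝ≥0∞}, Measurable u →
        ∫⁻ x, u x = ∫⁻ x, ∫⁻ y, u (e (x, y)) := by
      intro u hu
      rw [← hpres.lintegral_comp hu]
      exact lintegral_prod _ (hu.comp e.measurable).aemeasurable
    have hmeas : ∀ {u : (Fin (n + 1) → ℝ) → ℝ≥0∞}, Measurable u →
        Measurable fun x => ∫⁻ y, u (e (x, y)) := fun hu =>
      (hu.comp e.measurable).lintegral_prod_right'
    have hlin : ∀ x x' y y', e (a * x + b * x', a • y + b • y') = a • e (x, y) + b • e (x', y') := by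
      intro x x' y y'
      ext i
      refine Fin.cases ?_ (fun i => ?_) i <;>
        simp [he, MeasurableEquiv.piFinSuccAbove, Fin.insertNthEquiv]
    rw [hint hf, hint hg, hint hh]
    refine prekopaLeindler_real (hmeas hf) (hmeas hg) (hmeas hh) ha hb hab fun x x' => ?_
    refine prekopaLeindler_pi ha hb hab n
      (hf.comp (e.measurable.comp (by fun_prop))) (hg.comp (e.measurable.comp (by fun_prop)))
      (hh.comp (e.measurable.comp (by fun_prop))) fun y y' => ?_
    rw [hlin]
    exact H _ _

/-- The Prékopa-Leindler inequality on Euclidean space. -/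
theorem prekopaLeindler_euclidean {n : ℕ} {f g h : EuclideanSpace ℝ (Fin n) → ℝ≥0∞}
    (hf : Measurable f) (hg : Measurable g) (hh : Measurable h) {a b : ℝ} (ha : 0 < a)
    (hb : 0 < b) (hab : a + b = 1) (H : ∀ x y, f x ^ a * g y ^ b ≤ h (a • x + b • y)) :
    (∫⁻ x, f x) ^ a * (∫⁻ x, g x) ^ b ≤ ∫⁻ x, h x := by
  have hp := PiLp.volume_preserving_toLp (Fin n)
  rw [← hp.lintegral_comp hf, ← hp.lintegral_comp hg, ← hp.lintegral_comp hh]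
  refine prekopaLeindler_pi ha hb hab n (hf.comp hp.measurable) (hg.comp hp.measurable)
    (hh.comp hp.measurable) fun x y => ?_
  exact H _ _

/-! ### Log-concave measures and Borell's lemma -/

section LogConcave

variable {p : ℕ} {π : EuclideanSpace ℝ (Fin p) → ℝ}

theorem IsLogConcave.convex_support (h : IsLogConcave π) : Convex ℝ {x | 0 < π x} := by
  intro x hx y hy a b ha hb hab
  exact (mul_pos (Real.rpow_pos_of_pos hx a) (Real.rpow_pos_of_pos hy b)).trans_le
    (h.2 x y a b ha hb hab)

theorem IsLogConcave.concaveOn_log (h : IsLogConcave π) :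
    ConcaveOn ℝ {x | 0 < π x} fun x => Real.log (π x) := by
  refine ⟨h.convex_support, fun x hx y hy a b ha hb hab => ?_⟩
  have hx' : 0 < π x := hx
  have hy' : 0 < π y := hy
  have h1 := Real.log_le_log (mul_pos (Real.rpow_pos_of_pos hx a) (Real.rpow_pos_of_pos hy b))
    (h.2 x y a b ha hb hab)
  rwa [Real.log_mul (Real.rpow_pos_of_pos hx' a).ne' (Real.rpow_pos_of_pos hy' b).ne',
    Real.log_rpow hx', Real.log_rpow hy'] at h1

theorem IsLogConcave.continuousOn_interior (h : IsLogConcave π) :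
    ContinuousOn π (interior {x | 0 < π x}) := by
  refine (Real.continuous_exp.comp_continuousOn h.concaveOn_log.continuousOn_interior).congr ?_
  intro x hx
  have hx' : x ∈ {x | 0 < π x} := interior_subset hx
  exact (Real.exp_log hx').symm

/-- A log-concave function agrees almost everywhere with a Borel log-concave function. -/
theorem IsLogConcave.exists_measurable (h : IsLogConcave π) :
    ∃ ρ : EuclideanSpace ℝ (Fin p) → ℝ, Measurable ρ ∧ IsLogConcave ρ ∧ ρ =ᵐ[volume] π := by
  classical
  set U := interior {x | 0 < π x} with hU
  -- Keeping π only on the interior of its support, where it is continuous, gives measurability; the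
  -- discarded part lies in the boundary of a convex set, which is null.
  refine ⟨U.indicator π, ?_, ⟨fun x => indicator_nonneg (fun x _ => h.1 x) x, ?_⟩, ?_⟩
  · rw [← piecewise_eq_indicator]
    exact h.continuousOn_interior.measurable_piecewise continuousOn_const
      isOpen_interior.measurableSet
  · intro x y a b ha hb hab
    -- Zero weights are separated because 0 ^ 0 = 1; for positive weights the left side vanishes as
    -- soon as a point leaves U.
    by_cases ha0 : a = 0
    · obtain rfl : b = 1 := by linarith
      simp [ha0]
    by_cases hb0 : b = 0
    · obtain rfl : a = 1 := by linarith
      simp [hb0]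
    by_cases hx : x ∈ U
    · by_cases hy : y ∈ U
      · rw [indicator_of_mem hx, indicator_of_mem hy,
          indicator_of_mem (h.convex_support.interior hx hy ha hb hab)]
        exact h.2 x y a b ha hb hab
      · rw [indicator_of_notMem hy, Real.zero_rpow hb0, mul_zero]
        exact indicator_nonneg (fun x _ => h.1 x) _
    · rw [indicator_of_notMem hx, Real.zero_rpow ha0, zero_mul]
      exact indicator_nonneg (fun x _ => h.1 x) _
  · refine measure_mono_null (t := frontier {x | 0 < π x}) ?_
      (h.convex_support.addHaar_frontier volume)
    intro x hx
    have hxU : x ∉ U := fun hxU => hx (indicator_of_mem hxU π)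
    have h0 : π x ≠ 0 := fun h0 => hx ((indicator_of_notMem hxU π).trans h0.symm)
    exact ⟨subset_closure ((h.1 x).lt_of_ne' h0), hxU⟩

/-- Prékopa-Leindler for the density restricted to the three sets, after passing to a Borel version
of it. -/
theorem IsLogConcave.law_rpow_mul_rpow_le (h : IsLogConcave π)
    {A B C : Set (EuclideanSpace ℝ (Fin p))} (hA : MeasurableSet A) (hB : MeasurableSet B)
    (hC : MeasurableSet C) {a b : ℝ} (ha : 0 < a) (hb : 0 < b) (hab : a + b = 1)
    (H : ∀ x ∈ A, ∀ y ∈ B, a • x + b • y ∈ C) :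
    law π A ^ a * law π B ^ b ≤ law π C := by
  obtain ⟨ρ, hρ, hlc, hae⟩ := h.exists_measurable
  have hlaw : law π = law ρ := withDensity_congr_ae (hae.symm.fun_comp ENNReal.ofReal)
  have hval : ∀ {D : Set (EuclideanSpace ℝ (Fin p))}, MeasurableSet D →
      law π D = ∫⁻ x, D.indicator (fun x => ENNReal.ofReal (ρ x)) x := by
    intro D hD
    rw [hlaw, law, withDensity_apply _ hD, lintegral_indicator hD]
  have hm : Measurable fun x => ENNReal.ofReal (ρ x) := hρ.ennreal_ofReal
  rw [hval hA, hval hB, hval hC]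
  refine prekopaLeindler_euclidean (hm.indicator hA) (hm.indicator hB) (hm.indicator hC)
    ha hb hab fun x y => ?_
  by_cases hx : x ∈ A
  · by_cases hy : y ∈ B
    · rw [indicator_of_mem hx, indicator_of_mem hy, indicator_of_mem (H x hx y hy),
        ENNReal.ofReal_rpow_of_nonneg (hlc.1 x) ha.le, ENNReal.ofReal_rpow_of_nonneg (hlc.1 y) hb.le,
        ← ENNReal.ofReal_mul (Real.rpow_nonneg (hlc.1 x) a)]
      exact ENNReal.ofReal_le_ofReal (hlc.2 x y a b ha.le hb.le hab)
    · simp [indicator_of_notMem hy, ENNReal.zero_rpow_of_pos hb]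
  · simp [indicator_of_notMem hx, ENNReal.zero_rpow_of_pos ha]

theorem IsProbDensity.isProbabilityMeasure_law (h : IsProbDensity π) :
    IsProbabilityMeasure (law π) := by
  constructor
  rw [law, withDensity_apply _ MeasurableSet.univ, Measure.restrict_univ,
    ← ofReal_integral_eq_lintegral_ofReal h.integrable (Eventually.of_forall h.nonneg),
    h.integral_eq_one, ENNReal.ofReal_one]

/-- **Borell's lemma** for Euclidean balls: a log-concave probability measure giving mass at most
`1 / lam` to the complement of the ball of radius `r` has exponential tails. -/
theorem IsLogConcave.law_norm_gt_le (hπ : IsProbDensity π) (h : IsLogConcave π) {r lam : ℝ}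
    (hr : 0 < r) (hlam : 1 < lam) (hP : law π {x | r < ‖x‖} ≤ ENNReal.ofReal (1 / lam)) {s : ℝ}
    (hs : r ≤ s) :
    law π {x | s < ‖x‖} ≤
      ENNReal.ofReal (√(lam - 1) / lam * Real.exp (-(s * Real.log (lam - 1) / (2 * r)))) := by
  have := hπ.isProbabilityMeasure_law
  have hlam1 : 0 < lam - 1 := by linarith
  have hlam0 : 0 < lam := by linarith
  -- This is the form that comes out of solving the inequality `key2` for log q.
  have hB : √(lam - 1) / lam * Real.exp (-(s * Real.log (lam - 1) / (2 * r))) =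
      Real.exp (-Real.log lam - (s - r) / (2 * r) * Real.log (lam - 1)) := by
    rw [Real.sqrt_eq_rpow, Real.rpow_def_of_pos hlam1, ← Real.exp_log hlam0, Real.log_exp,
      ← Real.exp_sub, ← Real.exp_add, Real.exp_log hlam0]
    congr 1
    field_simp
    ring
  rw [hB]
  rcases hs.eq_or_lt with rfl | hs
  · refine hP.trans (le_of_eq ?_)
    rw [sub_self, zero_div, zero_mul, sub_zero, Real.exp_neg, Real.exp_log hlam0, one_div]
  have hsr : 0 < s + r := by linarith
  -- The weights solve a + b = 1 and a s - b r = r, so a point beyond radius s combined with one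
  -- inside the r-ball lands beyond radius r.
  set a := 2 * r / (s + r) with ha
  set b := (s - r) / (s + r) with hb
  have ha0 : 0 < a := by positivity
  have hb0 : 0 < b := div_pos (by linarith) hsr
  have hab : a + b = 1 := by rw [ha, hb]; field_simp; ring
  have hm : ∀ t : ℝ, MeasurableSet {x : EuclideanSpace ℝ (Fin p) | t < ‖x‖} := fun t =>
    measurableSet_lt measurable_const measurable_norm
  have hm' : MeasurableSet {x : EuclideanSpace ℝ (Fin p) | ‖x‖ ≤ r} :=
    measurableSet_le measurable_norm measurable_const
  have key := h.law_rpow_mul_rpow_le (hm s) hm' (hm r) ha0 hb0 hab (by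
    intro x hx y hy
    have hx : s < ‖x‖ := hx
    have hy : ‖y‖ ≤ r := hy
    change r < ‖a • x + b • y‖
    have h1 : a * ‖x‖ - b * ‖y‖ ≤ ‖a • x + b • y‖ := by
      have := norm_sub_norm_le (a • x) (-(b • y))
      rwa [norm_neg, sub_neg_eq_add, norm_smul, norm_smul, Real.norm_of_nonneg ha0.le,
        Real.norm_of_nonneg hb0.le] at this
    have h2 : a * s < a * ‖x‖ := by gcongr
    have h3 : b * ‖y‖ ≤ b * r := by gcongr
    have h4 : a * s - b * r = r := by rw [ha, hb]; field_simp; ring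
    linarith)
  have hθ : ENNReal.ofReal (1 - 1 / lam) ≤ law π {x | ‖x‖ ≤ r} := by
    have h1 : {x : EuclideanSpace ℝ (Fin p) | ‖x‖ ≤ r} = {x | r < ‖x‖}ᶜ := by
      ext x; simp
    rw [h1, prob_compl_eq_one_sub (hm r), ENNReal.ofReal_sub _ (by positivity), ENNReal.ofReal_one]
    exact tsub_le_tsub_left hP 1
  have hθ0 : 0 < 1 - 1 / lam := by rw [sub_pos, div_lt_one hlam0]; exact hlam
  set q := (law π {x | s < ‖x‖}).toReal with hq
  have hqe : law π {x | s < ‖x‖} = ENNReal.ofReal q :=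
    (ENNReal.ofReal_toReal (measure_ne_top _ _)).symm
  have hq0 : 0 ≤ q := ENNReal.toReal_nonneg
  have key2 : q ^ a * (1 - 1 / lam) ^ b ≤ 1 / lam := by
    have h1 : ENNReal.ofReal (q ^ a * (1 - 1 / lam) ^ b) ≤ ENNReal.ofReal (1 / lam) := by
      rw [ENNReal.ofReal_mul (by positivity), ← ENNReal.ofReal_rpow_of_nonneg hq0 ha0.le,
        ← ENNReal.ofReal_rpow_of_nonneg hθ0.le hb0.le, ← hqe]
      refine le_trans ?_ (key.trans hP)
      gcongr
    exact (ENNReal.ofReal_le_ofReal_iff (by positivity)).1 h1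
  rw [hqe]
  refine ENNReal.ofReal_le_ofReal ?_
  rcases hq0.eq_or_lt with hq0 | hq0
  · rw [← hq0]; positivity
  rw [← Real.log_le_iff_le_exp hq0]
  have h3 := Real.log_le_log (by positivity) key2
  rw [Real.log_mul (by positivity) (by positivity), Real.log_rpow hq0, Real.log_rpow hθ0,
    one_sub_div hlam0.ne', Real.log_div hlam1.ne' hlam0.ne', one_div, Real.log_inv] at h3
  have h4 : a * (Real.log q + Real.log lam) ≤ -(b * Real.log (lam - 1)) := by
    have : b = 1 - a := by linarith
    rw [this] at h3 ⊢
    linarith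
  -- Dividing by a leaves the decay exponent b/a = (s - r)/(2r).
  have h5 : b = a * ((s - r) / (2 * r)) := by rw [ha, hb]; field_simp
  rw [h5, mul_assoc, ← mul_neg] at h4
  have h6 := le_of_mul_le_mul_left h4 ha0
  linarith

end LogConcave

/-! ### Layer-cake moment bounds from exponential tails -/

theorem integrableOn_upperGamma {s x : ℝ} (hs : 0 < s) (hx : 0 ≤ x) :
    IntegrableOn (fun t : ℝ => t ^ (s - 1) * Real.exp (-t)) (Ioi x) := by
  refine ((Real.GammaIntegral_convergent hs).mono_set (Ioi_subset_Ioi hx)).congr_fun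
    (fun _ _ => mul_comm _ _) measurableSet_Ioi

theorem upperGamma_nonneg {s x : ℝ} (hx : 0 ≤ x) : 0 ≤ upperGamma s x :=
  setIntegral_nonneg measurableSet_Ioi fun _ ht =>
    mul_nonneg (Real.rpow_nonneg (hx.trans (le_of_lt ht)) _) (Real.exp_nonneg _)

/-- The tail integral of `s ^ (k - 1) * exp (-a * s)` in terms of the incomplete Gamma function. -/
theorem lintegral_Ioi_rpow_mul_exp {k a c C : ℝ} (hk : 0 < k) (ha : 0 < a) (hc : 0 ≤ c)
    (hC : 0 ≤ C) :
    ∫⁻ s in Ioi c, ENNReal.ofReal (C * Real.exp (-(a * s))) * ENNReal.ofReal (s ^ (k - 1)) =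
      ENNReal.ofReal (C * a⁻¹ ^ k * upperGamma k (a * c)) := by
  have hint : IntegrableOn (fun s : ℝ => (a * s) ^ (k - 1) * Real.exp (-(a * s))) (Ioi c) :=
    (integrableOn_Ioi_comp_mul_left_iff (fun t : ℝ => t ^ (k - 1) * Real.exp (-t)) c ha).2
      (integrableOn_upperGamma hk (mul_nonneg ha.le hc))
  have hval : ∫ s in Ioi c, (a * s) ^ (k - 1) * Real.exp (-(a * s)) = a⁻¹ * upperGamma k (a * c) :=
    integral_comp_mul_left_Ioi (fun t : ℝ => t ^ (k - 1) * Real.exp (-t)) c ha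
  have hA : a⁻¹ ^ (k - 1) * a⁻¹ = a⁻¹ ^ k := by
    rw [← Real.rpow_add_one (inv_pos.2 ha).ne', sub_add_cancel]
  have hrw : ∀ s ∈ Ioi c, ENNReal.ofReal (C * Real.exp (-(a * s))) * ENNReal.ofReal (s ^ (k - 1)) =
      ENNReal.ofReal (C * a⁻¹ ^ (k - 1) * ((a * s) ^ (k - 1) * Real.exp (-(a * s)))) := by
    intro s hs
    have hs0 : 0 ≤ s := hc.trans (le_of_lt hs)
    rw [← ENNReal.ofReal_mul (by positivity), Real.mul_rpow ha.le hs0, Real.inv_rpow ha.le]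
    congr 1
    have := (Real.rpow_pos_of_pos ha (k - 1)).ne'
    field_simp
  rw [setLIntegral_congr_fun measurableSet_Ioi hrw,
    ← ofReal_integral_eq_lintegral_ofReal (hint.const_mul _), integral_const_mul, hval,
    ← hA]
  · congr 1; ring
  · refine (ae_restrict_iff' measurableSet_Ioi).2 (Eventually.of_forall fun s hs => ?_)
    have hs0 : 0 ≤ s := hc.trans (le_of_lt hs)
    simp only [Pi.zero_apply]
    positivity

theorem lintegral_Ioc_rpow {m u v : ℝ} (hm : -1 < m) (hu : 0 ≤ u) (huv : u ≤ v) :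
    ∫⁻ s in Ioc u v, ENNReal.ofReal (s ^ m) =
      ENNReal.ofReal ((v ^ (m + 1) - u ^ (m + 1)) / (m + 1)) := by
  have hi := (intervalIntegral.intervalIntegrable_rpow' (a := u) (b := v) hm)
  rw [← ofReal_integral_eq_lintegral_ofReal ((intervalIntegrable_iff_integrableOn_Ioc_of_le huv).1 hi),
    ← intervalIntegral.integral_of_le huv, integral_rpow (Or.inl hm)]
  refine (ae_restrict_iff' measurableSet_Ioc).2 (Eventually.of_forall fun s hs => ?_)
  exact Real.rpow_nonneg (hu.trans hs.1.le) _

section Moments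

variable {Ω : Type*} [MeasurableSpace Ω] {P : Measure Ω}

/-- Layer-cake bound for moments of a nonnegative variable with exponential tails. -/
theorem lintegral_rpow_le_of_exp_tail {Y : Ω → ℝ} (hY : Measurable Y) (hY0 : ∀ ω, 0 ≤ Y ω)
    {k a c C : ℝ} (hk : 0 < k) (ha : 0 < a) (hc : 0 ≤ c) (hC : 0 ≤ C)
    (htail : ∀ s, c ≤ s → P {ω | s < Y ω} ≤ ENNReal.ofReal (C * Real.exp (-(a * s)))) :
    ∫⁻ ω, ENNReal.ofReal (Y ω ^ k) ∂P ≤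
      ENNReal.ofReal k * (∫⁻ s in Ioc 0 c, P {ω | s < Y ω} * ENNReal.ofReal (s ^ (k - 1))) +
        ENNReal.ofReal (C * a⁻¹ ^ k * k * upperGamma k (a * c)) := by
  rw [lintegral_rpow_eq_lintegral_meas_lt_mul P (Eventually.of_forall hY0) hY.aemeasurable hk,
    ← Ioc_union_Ioi_eq_Ioi hc, lintegral_union measurableSet_Ioi
      (Set.disjoint_left.2 fun x hx hx' => (hx.2.trans_lt hx').false), mul_add]
  gcongr
  have h1 : ∫⁻ s in Ioi c, P {ω | s < Y ω} * ENNReal.ofReal (s ^ (k - 1)) ≤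
      ENNReal.ofReal (C * a⁻¹ ^ k * upperGamma k (a * c)) := by
    rw [← lintegral_Ioi_rpow_mul_exp hk ha hc hC]
    refine setLIntegral_mono' measurableSet_Ioi fun s hs => ?_
    gcongr
    exact htail s (le_of_lt hs)
  refine (mul_le_mul_right h1 _).trans (le_of_eq ?_)
  rw [← ENNReal.ofReal_mul hk.le]
  congr 1
  ring

/-- Below c the trivial bound P ≤ 1 is enough, so no moment has to be known finite in advance. -/
theorem lintegral_rpow_lt_top_of_exp_tail [IsProbabilityMeasure P] {Y : Ω → ℝ} (hY : Measurable Y)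
    (hY0 : ∀ ω, 0 ≤ Y ω) {k a c C : ℝ} (hk : 0 < k) (ha : 0 < a) (hc : 0 ≤ c) (hC : 0 ≤ C)
    (htail : ∀ s, c ≤ s → P {ω | s < Y ω} ≤ ENNReal.ofReal (C * Real.exp (-(a * s)))) :
    ∫⁻ ω, ENNReal.ofReal (Y ω ^ k) ∂P < ∞ := by
  refine (lintegral_rpow_le_of_exp_tail hY hY0 hk ha hc hC htail).trans_lt ?_
  refine ENNReal.add_lt_top.2 ⟨ENNReal.mul_lt_top ENNReal.ofReal_lt_top ?_, ENNReal.ofReal_lt_top⟩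
  calc ∫⁻ s in Ioc 0 c, P {ω | s < Y ω} * ENNReal.ofReal (s ^ (k - 1))
      ≤ ∫⁻ s in Ioc 0 c, ENNReal.ofReal (s ^ (k - 1)) := by
        refine lintegral_mono fun s => ?_
        exact (mul_le_mul_left prob_le_one _).trans (one_mul _).le
    _ < ∞ := by
        rw [lintegral_Ioc_rpow (by linarith) le_rfl hc]
        exact ENNReal.ofReal_lt_top

/-- Chebyshev's inequality under the normalisation E Y² = 1. -/
theorem meas_gt_le_inv_sq {Y : Ω → ℝ} (hY : Measurable Y)
    (h2 : ∫⁻ ω, ENNReal.ofReal (Y ω ^ (2 : ℝ)) ∂P = 1) {s : ℝ} (hs : 0 < s) :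
    P {ω | s < Y ω} ≤ ENNReal.ofReal (1 / s ^ 2) := by
  have hs2 : 0 < s ^ 2 := by positivity
  have h1 := meas_ge_le_lintegral_div (μ := P) (f := fun ω => ENNReal.ofReal (Y ω ^ (2 : ℝ)))
    (hY.pow_const _).ennreal_ofReal.aemeasurable (ε := ENNReal.ofReal (s ^ 2))
    (by simpa using hs2.ne') ENNReal.ofReal_ne_top
  rw [h2, ← ENNReal.ofReal_one, ← ENNReal.ofReal_div_of_pos hs2] at h1
  refine (measure_mono fun ω hω => ?_).trans h1
  have hω : s < Y ω := hω
  refine ENNReal.ofReal_le_ofReal ?_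
  rw [Real.rpow_two]
  gcongr

/-- The moment bound for a variable with unit second moment and exponential tails. -/
theorem lintegral_rpow_le_of_unit_second_moment [IsProbabilityMeasure P] {Y : Ω → ℝ}
    (hY : Measurable Y) (hY0 : ∀ ω, 0 ≤ Y ω)
    (h2 : ∫⁻ ω, ENNReal.ofReal (Y ω ^ (2 : ℝ)) ∂P = 1)
    {k a c C : ℝ} (hk : 2 < k) (ha : 0 < a) (hc : 1 ≤ c) (hC : 0 ≤ C)
    (htail : ∀ s, c ≤ s → P {ω | s < Y ω} ≤ ENNReal.ofReal (C * Real.exp (-(a * s)))) :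
    ∫⁻ ω, ENNReal.ofReal (Y ω ^ k) ∂P ≤
      ENNReal.ofReal (C * a⁻¹ ^ k * k * upperGamma k (a * c) + (k * c ^ (k - 2) - 2) / (k - 2)) := by
  have hk0 : 0 < k := by linarith
  have hk2 : 0 < k - 2 := by linarith
  have hc0 : 0 ≤ c := by linarith
  -- The Chebyshev bound 1/s² beats the trivial bound 1 only for s > 1, hence the cut at 1.
  have hbody : ∫⁻ s in Ioc 0 c, P {ω | s < Y ω} * ENNReal.ofReal (s ^ (k - 1)) ≤
      ENNReal.ofReal (1 / k + (c ^ (k - 2) - 1) / (k - 2)) := by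
    rw [← Ioc_union_Ioc_eq_Ioc zero_le_one hc, lintegral_union measurableSet_Ioc
      (Set.disjoint_left.2 fun x hx hx' => (hx.2.trans_lt hx'.1).false)]
    have h1c : 1 ≤ c ^ (k - 2) := Real.one_le_rpow hc hk2.le
    rw [ENNReal.ofReal_add (by positivity) (div_nonneg (by linarith) hk2.le)]
    refine add_le_add ?_ ?_
    · calc ∫⁻ s in Ioc 0 1, P {ω | s < Y ω} * ENNReal.ofReal (s ^ (k - 1))
          ≤ ∫⁻ s in Ioc (0 : ℝ) 1, ENNReal.ofReal (s ^ (k - 1)) := by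
            refine lintegral_mono fun s => ?_
            exact (mul_le_mul_left prob_le_one _).trans (one_mul _).le
        _ = ENNReal.ofReal (1 / k) := by
            rw [lintegral_Ioc_rpow (by linarith) le_rfl zero_le_one]
            simp [hk0.ne']
    · calc ∫⁻ s in Ioc 1 c, P {ω | s < Y ω} * ENNReal.ofReal (s ^ (k - 1))
          ≤ ∫⁻ s in Ioc 1 c, ENNReal.ofReal (s ^ (k - 3)) := by
            refine setLIntegral_mono' measurableSet_Ioc fun s hs => ?_
            have hs0 : 0 < s := by linarith [hs.1]
            refine (mul_le_mul_left (meas_gt_le_inv_sq hY h2 hs0) _).trans (le_of_eq ?_)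
            rw [← ENNReal.ofReal_mul (by positivity)]
            congr 1
            rw [show k - 1 = k - 3 + (2 : ℕ) by push_cast; ring, Real.rpow_add_natCast hs0.ne']
            field_simp
        _ = ENNReal.ofReal ((c ^ (k - 2) - 1) / (k - 2)) := by
            rw [lintegral_Ioc_rpow (by linarith) zero_le_one hc, Real.one_rpow]
            rw [show k - 3 + 1 = k - 2 by ring]
  refine (lintegral_rpow_le_of_exp_tail hY hY0 hk0 ha hc0 hC htail).trans ?_
  have hG := upperGamma_nonneg (s := k) (mul_nonneg ha.le hc0)
  refine (add_le_add_left (mul_le_mul_right hbody _) _).trans (le_of_eq ?_)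
  have h1c : 1 ≤ c ^ (k - 2) := Real.one_le_rpow hc hk2.le
  have h0 : 0 ≤ (c ^ (k - 2) - 1) / (k - 2) := div_nonneg (by linarith) hk2.le
  rw [← ENNReal.ofReal_mul hk0.le, ← ENNReal.ofReal_add (by positivity) (by positivity)]
  congr 1
  field_simp
  ring

end Moments

/-! ### The moment inequality for log-concave densities -/

section LogConcave

variable {p : ℕ} {π : EuclideanSpace ℝ (Fin p) → ℝ}

theorem exists_law_norm_gt_le (hπ : IsProbDensity π) {ε : ℝ} (hε : 0 < ε) :
    ∃ r : ℝ, 0 < r ∧ law π {x | r < ‖x‖} ≤ ENNReal.ofReal ε := by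
  have := hπ.isProbabilityMeasure_law
  have hanti : Antitone fun n : ℕ => {x : EuclideanSpace ℝ (Fin p) | (n : ℝ) < ‖x‖} := by
    intro n m hnm x (hx : (m : ℝ) < ‖x‖)
    exact lt_of_le_of_lt (by exact_mod_cast hnm) hx
  have hlim := tendsto_measure_iInter_atTop (μ := law π)
    (fun n => (measurableSet_lt measurable_const measurable_norm).nullMeasurableSet) hanti
    ⟨0, measure_ne_top _ _⟩
  have hempty : ⋂ n : ℕ, {x : EuclideanSpace ℝ (Fin p) | (n : ℝ) < ‖x‖} = ∅ := by
    refine eq_empty_of_forall_notMem fun x hx => ?_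
    obtain ⟨n, hn⟩ := exists_nat_gt ‖x‖
    exact (hn.trans (mem_iInter.1 hx n)).false
  rw [hempty, measure_empty] at hlim
  obtain ⟨n, hn, hn0⟩ := ((hlim.eventually (gt_mem_nhds (ENNReal.ofReal_pos.2 hε))).and
    (eventually_gt_atTop 0)).exists
  exact ⟨n, by exact_mod_cast hn0, hn.le⟩

/-- All positive moments of a log-concave density are finite. -/
theorem IsLogConcave.integrable_norm_rpow (hπ : IsProbDensity π) (h : IsLogConcave π) {k : ℝ}
    (hk : 0 < k) : Integrable (fun x => ‖x‖ ^ k) (law π) := by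
  have := hπ.isProbabilityMeasure_law
  -- Borell's lemma is used with λ = 3; any λ > 2 would do, as only log(λ-1) > 0 matters.
  obtain ⟨r, hr, hP⟩ := exists_law_norm_gt_le hπ (ε := 1 / 3) (by norm_num)
  have hlog : 0 < Real.log (3 - 1) := Real.log_pos (by norm_num)
  have hfin := lintegral_rpow_lt_top_of_exp_tail (P := law π) (Y := fun x => ‖x‖)
    measurable_norm (fun x => norm_nonneg x) hk (a := Real.log (3 - 1) / (2 * r)) (c := r)
    (C := √(3 - 1) / 3) (by positivity) hr.le (by positivity) (by
      intro s hs
      refine (h.law_norm_gt_le hπ hr (by norm_num) hP hs).trans (le_of_eq ?_)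
      congr 4
      ring)
  refine ⟨(measurable_norm.pow_const k).aestronglyMeasurable, ?_⟩
  rw [hasFiniteIntegral_iff_ofReal (Eventually.of_forall fun x => by positivity)]
  exact hfin

theorem moment_nonneg (k : ℝ) : 0 ≤ moment π k :=
  integral_nonneg fun x => Real.rpow_nonneg (norm_nonneg x) k

/-- The moment inequality with parameters `lam` and `gam`. -/
theorem IsLogConcave.moment_le (hπ : IsProbDensity π) (h : IsLogConcave π) {k lam gam : ℝ}
    (hk : 2 < k) (hlam : 2 < lam) (hgam : 1 < gam) :
    moment π k ≤ momentConstAt k lam gam * moment π 2 ^ (k / 2) := by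
  have := hπ.isProbabilityMeasure_law
  have hk0 : 0 < k := by linarith
  have hlam0 : 0 < lam := by linarith
  have hint := h.integrable_norm_rpow hπ (k := 2) two_pos
  -- A zero second moment, as for p = 0, rules out rescaling; there the norm vanishes almost
  -- everywhere.
  rcases (moment_nonneg (π := π) 2).eq_or_lt with h0 | hpos
  · have hae : (fun x : EuclideanSpace ℝ (Fin p) => ‖x‖ ^ (2 : ℝ)) =ᵐ[law π] 0 :=
      (integral_eq_zero_iff_of_nonneg (fun x => Real.rpow_nonneg (norm_nonneg x) _) hint).1 h0.symm
    have hk' : moment π k = 0 := by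
      refine integral_eq_zero_of_ae ?_
      filter_upwards [hae] with x hx
      simp only [Pi.zero_apply] at hx ⊢
      rw [Real.rpow_eq_zero (norm_nonneg x) two_ne_zero] at hx
      rw [hx, Real.zero_rpow hk0.ne']
    rw [hk', ← h0, Real.zero_rpow (by positivity), mul_zero]
  set m := moment π 2 with hm
  set σ := √m with hσ
  have hσ0 : 0 < σ := Real.sqrt_pos.2 hpos
  have hσ2 : σ ^ 2 = m := Real.sq_sqrt hpos.le
  have hlog : 0 < Real.log (lam - 1) := Real.log_pos (by linarith)
  have hsq : 0 < √lam := Real.sqrt_pos.2 hlam0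
  set Y : EuclideanSpace ℝ (Fin p) → ℝ := fun x => ‖x‖ / σ with hY
  have hYm : Measurable Y := measurable_norm.div_const σ
  have hY0 : ∀ x, 0 ≤ Y x := fun x => by positivity
  have h2 : ∫⁻ x, ENNReal.ofReal (Y x ^ (2 : ℝ)) ∂(law π) = 1 := by
    have : ∀ x, Y x ^ (2 : ℝ) = ‖x‖ ^ (2 : ℝ) * m⁻¹ := by
      intro x
      rw [hY, Real.rpow_two, Real.rpow_two, div_pow, hσ2, div_eq_mul_inv]
    simp_rw [this]
    rw [← ofReal_integral_eq_lintegral_ofReal (hint.mul_const _)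
      (Eventually.of_forall fun x => by positivity), integral_mul_const]
    change ENNReal.ofReal (m * m⁻¹) = 1
    rw [mul_inv_cancel₀ hpos.ne', ENNReal.ofReal_one]
  have hset : ∀ s, {x | s < Y x} = {x | s * σ < ‖x‖} := by
    intro s
    ext x
    exact lt_div_iff₀ hσ0
  -- Borell's bound already holds from √λ on, but is used only from √(γλ): γ is free to balance it
  -- against Chebyshev.
  set c := √(gam * lam) with hc
  have hlc : √lam ≤ c := Real.sqrt_le_sqrt (by nlinarith)
  have h1c : 1 ≤ c := le_trans (Real.one_le_sqrt.2 (by linarith)) hlc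
  have htail : ∀ s, c ≤ s → law π {x | s < Y x} ≤ ENNReal.ofReal
      (√(lam - 1) / lam * Real.exp (-(Real.log (lam - 1) / (2 * √lam) * s))) := by
    intro s hs
    rw [hset]
    have hP : law π {x | √lam * σ < ‖x‖} ≤ ENNReal.ofReal (1 / lam) := by
      rw [← hset]
      simpa [Real.sq_sqrt hlam0.le] using meas_gt_le_inv_sq hYm h2 hsq
    refine (h.law_norm_gt_le hπ (by positivity) (by linarith) hP (s := s * σ)
      (by gcongr; exact hlc.trans hs)).trans (le_of_eq ?_)
    congr 4
    field_simp
  have key := lintegral_rpow_le_of_unit_second_moment hYm hY0 h2 hk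
    (a := Real.log (lam - 1) / (2 * √lam)) (by positivity) h1c
    (div_nonneg (Real.sqrt_nonneg _) hlam0.le) htail
  have hconst : √(lam - 1) / lam * (Real.log (lam - 1) / (2 * √lam))⁻¹ ^ k * k *
      upperGamma k (Real.log (lam - 1) / (2 * √lam) * c) + (k * c ^ (k - 2) - 2) / (k - 2) =
      momentConstAt k lam gam := by
    have h1 : Real.log (lam - 1) / (2 * √lam) * c = gam ^ (1 / 2 : ℝ) * Real.log (lam - 1) / 2 := by
      rw [hc, Real.sqrt_mul (by linarith), ← Real.sqrt_eq_rpow]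
      field_simp
    have h3 : c ^ (k - 2) = (gam * lam) ^ (k / 2 - 1) := by
      rw [hc, Real.sqrt_eq_rpow, ← Real.rpow_mul (by positivity)]
      congr 1; ring
    rw [h1, h3, inv_div, momentConstAt]
  rw [hconst] at key
  have hintk := h.integrable_norm_rpow hπ hk0
  have hσk : σ ^ k = m ^ (k / 2) := by
    rw [hσ, Real.sqrt_eq_rpow, ← Real.rpow_mul hpos.le]
    congr 1; ring
  have hmk : 0 < m ^ (k / 2) := Real.rpow_pos_of_pos hpos _
  have hYk : ∀ x, Y x ^ k = ‖x‖ ^ k * (m ^ (k / 2))⁻¹ := by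
    intro x
    rw [hY, Real.div_rpow (norm_nonneg x) hσ0.le, hσk, div_eq_mul_inv]
  simp_rw [hYk] at key
  rw [← ofReal_integral_eq_lintegral_ofReal (hintk.mul_const _)
      (Eventually.of_forall fun x => by positivity), integral_mul_const] at key
  change ENNReal.ofReal (moment π k * (m ^ (k / 2))⁻¹) ≤ _ at key
  have hnn : 0 ≤ momentConstAt k lam gam := by
    rw [← hconst]
    have hG := upperGamma_nonneg (s := k)
      (mul_nonneg (by positivity : 0 ≤ Real.log (lam - 1) / (2 * √lam)) (zero_le_one.trans h1c))
    have h1 : 1 ≤ c ^ (k - 2) := Real.one_le_rpow h1c (by linarith)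
    have h3 : 0 ≤ (k * c ^ (k - 2) - 2) / (k - 2) := div_nonneg (by nlinarith) (by linarith)
    positivity
  rw [ENNReal.ofReal_le_ofReal_iff hnn, ← div_eq_mul_inv, div_le_iff₀ hmk] at key
  exact key

end LogConcave

/-! ### Calculus of the incomplete Gamma function -/

theorem hasDerivAt_upperGamma {k x : ℝ} (hk : 0 < k) (hx : 0 < x) :
    HasDerivAt (upperGamma k) (-(x ^ (k - 1) * Real.exp (-x))) x := by
  have hcont : ∀ y : ℝ, 0 < y → ContinuousAt (fun t : ℝ => t ^ (k - 1) * Real.exp (-t)) y :=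
    fun y hy => (Real.continuousAt_rpow_const y (k - 1) (Or.inl hy.ne')).mul
      (Real.continuous_exp.comp continuous_neg).continuousAt
  have h1 : HasDerivAt (fun y => ∫ t in (0 : ℝ)..y, t ^ (k - 1) * Real.exp (-t))
      (x ^ (k - 1) * Real.exp (-x)) x := by
    refine intervalIntegral.integral_hasDerivAt_right ?_ ?_ (hcont x hx)
    · rw [intervalIntegrable_iff_integrableOn_Ioc_of_le hx.le]
      exact (integrableOn_upperGamma hk le_rfl).mono_set Ioc_subset_Ioi_self
    · exact ContinuousOn.stronglyMeasurableAtFilter isOpen_Ioi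
        (fun y hy => (hcont y hy).continuousWithinAt) x hx
  refine (h1.const_sub (upperGamma k 0)).congr_of_eventuallyEq ?_
  filter_upwards [lt_mem_nhds hx] with y hy
  rw [eq_sub_iff_add_eq, add_comm]
  exact intervalIntegral.integral_interval_add_Ioi (integrableOn_upperGamma hk le_rfl)
    (integrableOn_upperGamma hk hy.le)

/-- Integration by parts, with antiderivative -t^k e^(-t) vanishing at infinity. -/
theorem upperGamma_add_one {k x : ℝ} (hk : 0 < k) (hx : 0 < x) :
    upperGamma (k + 1) x = k * upperGamma k x + x ^ k * Real.exp (-x) := by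
  have hi := integrableOn_upperGamma hk hx.le
  have hi' := integrableOn_upperGamma (s := k + 1) (by linarith) hx.le
  have hd : ∀ t ∈ Ici x, HasDerivAt (fun t : ℝ => -(t ^ k * Real.exp (-t)))
      (t ^ (k + 1 - 1) * Real.exp (-t) - k * (t ^ (k - 1) * Real.exp (-t))) t := by
    intro t ht
    have ht0 : 0 < t := hx.trans_le ht
    refine (((Real.hasDerivAt_rpow_const (p := k) (Or.inl ht0.ne')).mul
      (hasDerivAt_neg t).exp).neg).congr_deriv ?_
    rw [add_sub_cancel_right]
    ring
  have hlim : Tendsto (fun t : ℝ => -(t ^ k * Real.exp (-t))) atTop (𝓝 0) := by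
    simpa using (tendsto_rpow_mul_exp_neg_mul_atTop_nhds_zero k 1 one_pos).neg
  have := integral_Ioi_of_hasDerivAt_of_tendsto' hd (hi'.sub (hi.const_mul k)) hlim
  rw [integral_sub hi' (hi.const_mul k), integral_const_mul] at this
  change upperGamma (k + 1) x - k * upperGamma k x = _ at this
  linarith

theorem setIntegral_Ioi_pos {f : ℝ → ℝ} {x : ℝ} (hf : IntegrableOn f (Ioi x))
    (hpos : ∀ t ∈ Ioi x, 0 < f t) : 0 < ∫ t in Ioi x, f t := by
  refine (setIntegral_pos_iff_support_of_nonneg_ae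
    ((ae_restrict_iff' measurableSet_Ioi).2 (Eventually.of_forall fun t ht => (hpos t ht).le))
    hf).2 ?_
  have hsub : Ioi x ⊆ Function.support f := fun t ht => Function.mem_support.2 (hpos t ht).ne'
  rw [inter_eq_right.2 hsub, Real.volume_Ioi]
  exact ENNReal.zero_lt_top

theorem upperGamma_pos {k x : ℝ} (hk : 0 < k) (hx : 0 ≤ x) : 0 < upperGamma k x := by
  have hpos : ∀ t ∈ Ioi x, 0 < t ^ (k - 1) * Real.exp (-t) := fun t ht =>
    mul_pos (Real.rpow_pos_of_pos (hx.trans_lt ht) _) (Real.exp_pos _)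
  exact setIntegral_Ioi_pos (integrableOn_upperGamma hk hx) hpos

/-- The integrands compare pointwise, since t > x on the domain. This supplies the strictness in
`exists_momentConstAt_lt_of_le_log`. -/
theorem mul_upperGamma_lt {k x : ℝ} (hk : 0 < k) (hx : 0 < x) :
    x * upperGamma k x < upperGamma (k + 1) x := by
  have hi := integrableOn_upperGamma hk hx.le
  have hi' := integrableOn_upperGamma (s := k + 1) (by linarith) hx.le
  have hpos : ∀ t ∈ Ioi x,
      0 < t ^ (k + 1 - 1) * Real.exp (-t) - x * (t ^ (k - 1) * Real.exp (-t)) := by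
    intro t ht
    have ht0 : 0 < t := hx.trans ht
    have h1 : t ^ (k + 1 - 1) = t ^ (k - 1) * t := by
      rw [← Real.rpow_add_one ht0.ne']; congr 1; ring
    have h2 : 0 < t - x := sub_pos.2 ht
    have h3 : t ^ (k + 1 - 1) * Real.exp (-t) - x * (t ^ (k - 1) * Real.exp (-t)) =
        t ^ (k - 1) * Real.exp (-t) * (t - x) := by rw [h1]; ring
    rw [h3]
    positivity
  have h := setIntegral_Ioi_pos (hi'.sub (hi.const_mul x)) hpos
  rw [integral_sub' hi' (hi.const_mul x), integral_const_mul] at h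
  exact sub_pos.1 h

theorem upperGamma_one {x : ℝ} : upperGamma 1 x = Real.exp (-x) := by
  simp [upperGamma, integral_exp_Iic]

theorem upperGamma_anti {k x y : ℝ} (hk : 0 < k) (hx : 0 ≤ x) (hxy : x ≤ y) :
    upperGamma k y ≤ upperGamma k x := by
  refine setIntegral_mono_set (integrableOn_upperGamma hk hx) ?_
    (Ioi_subset_Ioi hxy).eventuallyLE
  exact (ae_restrict_iff' measurableSet_Ioi).2 (Eventually.of_forall fun t ht =>
    mul_nonneg (Real.rpow_nonneg (hx.trans (le_of_lt ht)) _) (Real.exp_nonneg _))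

theorem exists_lt_of_hasDerivAt_pos {f : ℝ → ℝ} {f' x u : ℝ} (hf : HasDerivAt f f' x)
    (hf' : 0 < f') (hu : u < x) : ∃ y, u < y ∧ y < x ∧ f y < f x := by
  have h := (hasDerivAt_iff_tendsto_slope_left_right.1 hf).1
  obtain ⟨y, ⟨hy, hyx⟩, hyu⟩ := (((h.eventually (lt_mem_nhds hf')).and
    self_mem_nhdsWithin).and (mem_nhdsWithin_of_mem_nhds (lt_mem_nhds hu))).exists
  have hyx : y < x := hyx
  refine ⟨y, hyu, hyx, ?_⟩
  rw [slope_def_field] at hy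
  have := (div_pos_iff.1 hy).resolve_left fun h => (sub_neg.2 hyx).not_gt h.2
  linarith [this.1]

/-! ### Numerical values for k = 3 and k = 4 -/

theorem upperGamma_three {x : ℝ} (hx : 0 < x) :
    upperGamma 3 x = (x ^ 2 + 2 * x + 2) * Real.exp (-x) := by
  rw [show (3 : ℝ) = 1 + 1 + 1 by norm_num, upperGamma_add_one (by norm_num) hx,
    upperGamma_add_one one_pos hx, upperGamma_one, show (1 : ℝ) + 1 = 2 by norm_num,
    Real.rpow_two, Real.rpow_one]
  ring

theorem upperGamma_four {x : ℝ} (hx : 0 < x) :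
    upperGamma 4 x = (x ^ 3 + 3 * x ^ 2 + 6 * x + 6) * Real.exp (-x) := by
  rw [show (4 : ℝ) = 3 + 1 by norm_num, upperGamma_add_one (by norm_num) hx, upperGamma_three hx,
    show (3 : ℝ) = ((3 : ℕ) : ℝ) by norm_num, Real.rpow_natCast]
  push_cast
  ring

/-- The constants in the parametrization `lam = 1 + exp L`, `gam = (2 * x / L) ^ 2`. -/
theorem momentConstAt_one_add_exp {k L x : ℝ} (hL : 0 < L) (hx : 0 < x) :
    momentConstAt k (1 + Real.exp L) ((2 * x / L) ^ 2) =
      Real.exp (L / 2) / (1 + Real.exp L) * (2 * √(1 + Real.exp L) / L) ^ k * k * upperGamma k x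
        + (k * (2 * x / L * √(1 + Real.exp L)) ^ (k - 2) - 2) / (k - 2) := by
  have h1 : √(Real.exp L) = Real.exp (L / 2) := (Real.exp_half L).symm
  have h2 : ((2 * x / L) ^ 2) ^ (1 / 2 : ℝ) = 2 * x / L := by
    rw [← Real.sqrt_eq_rpow, Real.sqrt_sq (by positivity)]
  have h3 : ((2 * x / L) ^ 2 * (1 + Real.exp L)) ^ (k / 2 - 1) =
      (2 * x / L * √(1 + Real.exp L)) ^ (k - 2) := by
    have : (2 * x / L) ^ 2 * (1 + Real.exp L) = (2 * x / L * √(1 + Real.exp L)) ^ (2 : ℝ) := by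
      rw [Real.rpow_two, mul_pow, Real.sq_sqrt (by positivity)]
    rw [this, ← Real.rpow_mul (by positivity)]
    congr 1; ring
  rw [momentConstAt, add_sub_cancel_left, Real.log_exp, h1, h2, h3,
    show 2 * x / L * L / 2 = x by field_simp]

/-- Any admissible pair bounds the minimum from above; this one is L = 2.7 and x = 2.8, where x is
the Gamma argument, and γ > 1 because 2x > L. -/
theorem momentConstAt_three_le :
    momentConstAt 3 (1 + Real.exp 2.7) ((2 * 2.8 / 2.7) ^ 2) ≤ 40.40 := by
  rw [momentConstAt_one_add_exp (by norm_num) (by norm_num), upperGamma_three (by norm_num)]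
  set w := √(1 + Real.exp 2.7) with hw
  have hw0 : 0 < w := Real.sqrt_pos.2 (by positivity)
  have hw2 : w ^ 2 = 1 + Real.exp 2.7 := Real.sq_sqrt (by positivity)
  have he : Real.exp 2.7 ≤ 14.87974 := by
    -- The Taylor bound `Real.exp_bound'` needs an argument at most 1, so 2.7 is divided by 3.
    have h1 : Real.exp 0.9 ≤ 2.4596032 := by
      refine (Real.exp_bound' (n := 12) (by norm_num) (by norm_num) (by norm_num)).trans ?_
      norm_num [Finset.sum_range_succ, Nat.factorial]
    have h2 : Real.exp 2.7 = Real.exp 0.9 ^ 3 := by rw [← Real.exp_nat_mul]; norm_num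
    rw [h2]
    calc Real.exp 0.9 ^ 3 ≤ 2.4596032 ^ 3 := by gcongr
      _ ≤ _ := by norm_num
  have hwle : w ≤ 3.98494 := by
    rw [hw, Real.sqrt_le_left (by norm_num)]
    linarith
  have hexp : Real.exp (2.7 / 2) * Real.exp (-2.8) ≤ 0.234571 := by
    rw [← Real.exp_add, show (2.7 / 2 + -2.8 : ℝ) = -1.45 by norm_num, Real.exp_neg]
    rw [inv_le_comm₀ (Real.exp_pos _) (by norm_num)]
    refine le_trans ?_ (Real.sum_le_exp_of_nonneg (by norm_num) 14)
    norm_num [Finset.sum_range_succ, Nat.factorial]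
  rw [show (3 : ℝ) - 2 = 1 by norm_num, Real.rpow_one, ← hw2,
    show (3 : ℝ) = ((3 : ℕ) : ℝ) by norm_num, Real.rpow_natCast]
  -- As w² = 1 + e^L cancels the denominator, the expression increases in w and in e^(L/2 - x), and
  -- upper bounds on these two suffice.
  calc _ = w * (24 * (Real.exp (2.7 / 2) * Real.exp (-2.8)) * (2.8 ^ 2 + 2 * 2.8 + 2) / 2.7 ^ 3
        + 6 * 2.8 / 2.7) - 2 := by
        push_cast
        field_simp
        ring
    _ ≤ 3.98494 * (24 * 0.234571 * (2.8 ^ 2 + 2 * 2.8 + 2) / 2.7 ^ 3 + 6 * 2.8 / 2.7) - 2 := by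
        gcongr
    _ ≤ 40.40 := by norm_num

theorem momentConstAt_four_le :
    momentConstAt 4 (1 + Real.exp 2.64) ((2 * 2.88 / 2.64) ^ 2) ≤ 441.43 := by
  rw [momentConstAt_one_add_exp (by norm_num) (by norm_num), upperGamma_four (by norm_num)]
  set w := √(1 + Real.exp 2.64) with hw
  have hw0 : 0 < w := Real.sqrt_pos.2 (by positivity)
  have hw2 : w ^ 2 = 1 + Real.exp 2.64 := Real.sq_sqrt (by positivity)
  have he : Real.exp 2.64 ≤ 14.013205 := by
    have h1 : Real.exp 0.88 ≤ 2.4108997065 := by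
      refine (Real.exp_bound' (n := 14) (by norm_num) (by norm_num) (by norm_num)).trans ?_
      norm_num [Finset.sum_range_succ, Nat.factorial]
    have h2 : Real.exp 2.64 = Real.exp 0.88 ^ 3 := by rw [← Real.exp_nat_mul]; norm_num
    rw [h2]
    calc Real.exp 0.88 ^ 3 ≤ 2.4108997065 ^ 3 := by gcongr
      _ ≤ _ := by norm_num
  have hwle : w ^ 2 ≤ 15.013205 := by
    rw [hw2]
    linarith
  have hexp : Real.exp (2.64 / 2) * Real.exp (-2.88) ≤ 0.2101361 := by
    rw [← Real.exp_add, show (2.64 / 2 + -2.88 : ℝ) = -1.56 by norm_num, Real.exp_neg]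
    rw [inv_le_comm₀ (Real.exp_pos _) (by norm_num)]
    refine le_trans ?_ (Real.sum_le_exp_of_nonneg (by norm_num) 16)
    norm_num [Finset.sum_range_succ, Nat.factorial]
  rw [show (4 : ℝ) - 2 = 2 by norm_num, Real.rpow_two, ← hw2,
    show (4 : ℝ) = ((4 : ℕ) : ℝ) by norm_num, Real.rpow_natCast]
  calc _ = w ^ 2 * (64 * (Real.exp (2.64 / 2) * Real.exp (-2.88)) *
        (2.88 ^ 3 + 3 * 2.88 ^ 2 + 6 * 2.88 + 6) / 2.64 ^ 4 + 8 * 2.88 ^ 2 / 2.64 ^ 2) - 1 := by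
        push_cast
        field_simp
        ring
    _ ≤ 15.013205 * (64 * 0.2101361 * (2.88 ^ 3 + 3 * 2.88 ^ 2 + 6 * 2.88 + 6) / 2.64 ^ 4
        + 8 * 2.88 ^ 2 / 2.64 ^ 2) - 1 := by
        gcongr
    _ ≤ 441.43 := by norm_num

/-! ### Attainment of the minimum -/

section Minimum

variable {k : ℝ}

theorem continuousOn_momentConstAt (hk : 2 < k) :
    ContinuousOn (fun q : ℝ × ℝ => momentConstAt k q.1 q.2) {q | 2 < q.1 ∧ 1 ≤ q.2} := by
  intro q hq
  refine ContinuousAt.continuousWithinAt ?_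
  obtain ⟨h1, h2⟩ := hq
  have hlog : 0 < Real.log (q.1 - 1) := Real.log_pos (by linarith)
  have hq1 : q.1 ≠ 0 := by linarith
  have hq11 : q.1 - 1 ≠ 0 := by linarith
  have hq2 : 0 < q.2 := by linarith
  have hcl : ContinuousAt (fun q : ℝ × ℝ => Real.log (q.1 - 1)) q :=
    ContinuousAt.log (by fun_prop) hq11
  have harg : ContinuousAt (fun q : ℝ × ℝ => q.2 ^ (1 / 2 : ℝ) * Real.log (q.1 - 1) / 2) q :=
    ((continuousAt_snd.rpow_const (Or.inl hq2.ne')).mul hcl).div_const 2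
  have hG : ContinuousAt (fun q : ℝ × ℝ =>
      upperGamma k (q.2 ^ (1 / 2 : ℝ) * Real.log (q.1 - 1) / 2)) q :=
    ContinuousAt.comp (g := upperGamma k)
      (hasDerivAt_upperGamma (by linarith) (by positivity)).continuousAt harg
  have hs : ContinuousAt (fun q : ℝ × ℝ => √(q.1 - 1) / q.1) q :=
    ContinuousAt.div (by fun_prop) continuousAt_fst hq1
  have hp : ContinuousAt (fun q : ℝ × ℝ => (2 * √q.1 / Real.log (q.1 - 1)) ^ k) q :=
    (ContinuousAt.div (by fun_prop) hcl hlog.ne').rpow_const (Or.inr (by linarith))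
  have hr : ContinuousAt (fun q : ℝ × ℝ => (q.2 * q.1) ^ (k / 2 - 1)) q :=
    ContinuousAt.rpow_const (by fun_prop) (Or.inr (by linarith))
  exact (((hs.mul hp).mul continuousAt_const).mul hG).add
    (((continuousAt_const.mul hr).sub continuousAt_const).div_const _)

theorem momentConstAt_body_nonneg (hk : 2 < k) {u : ℝ} (hu : 1 ≤ u) :
    0 ≤ (k * u ^ (k / 2 - 1) - 2) / (k - 2) := by
  have h1 : 1 ≤ u ^ (k / 2 - 1) := Real.one_le_rpow hu (by linarith)
  exact div_nonneg (by nlinarith) (by linarith)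

theorem momentConstAt_tail_nonneg (hk : 2 < k) {lam gam : ℝ} (hlam : 2 < lam) (hgam : 1 ≤ gam) :
    0 ≤ √(lam - 1) / lam * (2 * √lam / Real.log (lam - 1)) ^ k * k *
      upperGamma k (gam ^ (1 / 2 : ℝ) * Real.log (lam - 1) / 2) := by
  have hlog : 0 < Real.log (lam - 1) := Real.log_pos (by linarith)
  have hG := upperGamma_nonneg (s := k)
    (by positivity : 0 ≤ gam ^ (1 / 2 : ℝ) * Real.log (lam - 1) / 2)
  have : 0 < lam := by linarith
  positivity

/-- Sublevel sets of the two-parameter constant lie in a compact box. -/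
theorem exists_box_of_momentConstAt_le (hk : 2 < k) (V : ℝ) :
    ∃ δ > 0, ∃ R : ℝ, ∀ lam gam : ℝ, 2 < lam → 1 ≤ gam → momentConstAt k lam gam ≤ V →
      lam ∈ Icc (2 + δ) R ∧ gam ∈ Icc 1 R := by
  have hk0 : 0 < k := by linarith
  have hk2 : 0 < k - 2 := by linarith
  have hlim : Tendsto (fun u : ℝ => (k * u ^ (k / 2 - 1) - 2) / (k - 2)) atTop atTop :=
    (tendsto_atTop_add_const_right _ (-2)
      ((tendsto_rpow_atTop (by linarith : 0 < k / 2 - 1)).const_mul_atTop hk0)).atTop_div_const hk2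
  -- The power term alone exceeds V once γλ ≥ R; this bounds both parameters above.
  obtain ⟨R, hR⟩ := eventually_atTop.1 (hlim.eventually (eventually_gt_atTop V))
  set S := max R 2 with hS
  have hS2 : 2 ≤ S := le_max_right _ _
  have hG := upperGamma_pos hk0 (by positivity : 0 ≤ S ^ 2)
  -- W will bound 1/log(λ-1): the Gamma term blows up as λ decreases to 2, and log(λ-1) ≤ λ-2 turns
  -- this into a gap δ = 1/W.
  set W := max 1 (V * S / (k * upperGamma k (S ^ 2))) with hW
  have hW1 : 1 ≤ W := le_max_left _ _
  refine ⟨1 / W, by positivity, S, fun lam gam hlam hgam hV => ?_⟩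
  have hlog : 0 < Real.log (lam - 1) := Real.log_pos (by linarith)
  have hlam0 : 0 < lam := by linarith
  have h1 := momentConstAt_tail_nonneg hk hlam hgam
  have h2 := momentConstAt_body_nonneg hk (u := gam * lam) (by nlinarith)
  unfold momentConstAt at hV
  have hprod : gam * lam < R := by
    by_contra! hle
    linarith [hR _ hle]
  have hprodS : gam * lam < S := hprod.trans_le (le_max_left _ _)
  have hlamS : lam ≤ S := by nlinarith
  have hgamS : gam ≤ S := by nlinarith
  refine ⟨⟨?_, hlamS⟩, hgam, hgamS⟩
  have hlogle : Real.log (lam - 1) ≤ lam - 2 := by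
    linarith [Real.log_le_sub_one_of_pos (by linarith : 0 < lam - 1)]
  rcases le_or_gt 1 (Real.log (lam - 1)) with hl1 | hl1
  · have : 1 / W ≤ 1 := by rw [div_le_one (by linarith)]; exact hW1
    linarith
  have hx : gam ^ (1 / 2 : ℝ) * Real.log (lam - 1) / 2 ≤ S ^ 2 := by
    have h3 : gam ^ (1 / 2 : ℝ) ≤ gam := by
      conv_rhs => rw [← Real.rpow_one gam]
      exact Real.rpow_le_rpow_of_exponent_le hgam (by norm_num)
    have h4 : gam ^ (1 / 2 : ℝ) * Real.log (lam - 1) ≤ gam * 1 := by gcongr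
    nlinarith
  have hGle := upperGamma_anti hk0 (by positivity) hx
  have hC : 1 / S ≤ √(lam - 1) / lam := by
    have : 1 ≤ √(lam - 1) := Real.one_le_sqrt.2 (by linarith)
    gcongr
  have hpow : 1 / Real.log (lam - 1) ≤ (2 * √lam / Real.log (lam - 1)) ^ k := by
    have h3 : 1 ≤ √lam := Real.one_le_sqrt.2 (by linarith)
    have h4 : 1 / Real.log (lam - 1) ≤ 2 * √lam / Real.log (lam - 1) := by gcongr; linarith
    have h5 : 1 ≤ 1 / Real.log (lam - 1) := by rw [le_div_iff₀ hlog]; linarith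
    calc 1 / Real.log (lam - 1) = (1 / Real.log (lam - 1)) ^ (1 : ℝ) := (Real.rpow_one _).symm
      _ ≤ (1 / Real.log (lam - 1)) ^ k := Real.rpow_le_rpow_of_exponent_le h5 (by linarith)
      _ ≤ _ := by gcongr
  have hlow : 1 / S * (1 / Real.log (lam - 1)) * k * upperGamma k (S ^ 2) ≤ V := by
    calc _ ≤ √(lam - 1) / lam * (2 * √lam / Real.log (lam - 1)) ^ k * k *
          upperGamma k (gam ^ (1 / 2 : ℝ) * Real.log (lam - 1) / 2) := by gcongr
      _ ≤ V := by linarith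
  have hinv : 1 / Real.log (lam - 1) ≤ W := by
    refine le_trans ?_ (le_max_right _ _)
    rw [le_div_iff₀ (by positivity)]
    calc 1 / Real.log (lam - 1) * (k * upperGamma k (S ^ 2))
        = (1 / S * (1 / Real.log (lam - 1)) * k * upperGamma k (S ^ 2)) * S := by field_simp
      _ ≤ V * S := by gcongr
  have : 1 / W ≤ Real.log (lam - 1) := by
    rw [div_le_iff₀ (by linarith)]
    rw [div_le_iff₀ hlog] at hinv
    linarith
  linarith

/-- The constant has a minimum over the half-closed parameter domain. -/
theorem exists_isMin_momentConstAt (hk : 2 < k) :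
    ∃ lam gam : ℝ, 2 < lam ∧ 1 ≤ gam ∧ ∀ lam' gam' : ℝ, 2 < lam' → 1 ≤ gam' →
      momentConstAt k lam gam ≤ momentConstAt k lam' gam' := by
  obtain ⟨δ, hδ, R, hbox⟩ := exists_box_of_momentConstAt_le hk (momentConstAt k 3 1)
  have h31 := hbox 3 1 (by norm_num) le_rfl le_rfl
  have hsub : Icc (2 + δ) R ×ˢ Icc 1 R ⊆ {q : ℝ × ℝ | 2 < q.1 ∧ 1 ≤ q.2} := by
    rintro ⟨l, g⟩ ⟨⟨h1, -⟩, ⟨h2, -⟩⟩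
    exact ⟨by simp only at h1 ⊢; linarith, h2⟩
  obtain ⟨q, hq, hmin⟩ := (isCompact_Icc.prod isCompact_Icc).exists_isMinOn
    (⟨(3, 1), h31⟩ : (Icc (2 + δ) R ×ˢ Icc (1 : ℝ) R).Nonempty)
    ((continuousOn_momentConstAt hk).mono hsub)
  refine ⟨q.1, q.2, (hsub hq).1, (hsub hq).2, fun lam' gam' h1 h2 => ?_⟩
  rcases le_total (momentConstAt k lam' gam') (momentConstAt k 3 1) with hle | hle
  · exact isMinOn_iff.1 hmin (lam', gam') (hbox lam' gam' h1 h2 hle)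
  · exact (isMinOn_iff.1 hmin (3, 1) h31).trans hle

/-- For small `lam`, moving `gam` away from `1` decreases the constant. -/
theorem exists_momentConstAt_lt_of_log_lt (hk : 2 < k) {lam : ℝ} (hlam : 2 < lam)
    (hL : Real.log (lam - 1) < 4) : ∃ gam : ℝ, 1 < gam ∧
      momentConstAt k lam gam < momentConstAt k lam 1 := by
  set L := Real.log (lam - 1) with hLdef
  have hL0 : 0 < L := Real.log_pos (by linarith)
  have hlam0 : 0 < lam := by linarith
  have hk0 : 0 < k := by linarith
  have hT : 1 < 4 / L := by rw [lt_div_iff₀ hL0]; linarith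
  set D := √(lam - 1) / lam * (2 * √lam / L) ^ k * k with hD
  -- With t = √γ, φ'(t) is k λ^(k/2-1) (t^(k-3) - t^(k-1) e^(-(t-1)L/2)). It vanishes at t = 1, so
  -- its sign is studied on a whole interval to the right of 1.
  set φ : ℝ → ℝ := fun t => D * upperGamma k (t * (L / 2)) +
    (k * (t ^ (k - 2) * lam ^ (k / 2 - 1)) - 2) / (k - 2) with hφ
  have hφeq : ∀ t, 0 < t → momentConstAt k lam (t ^ 2) = φ t := by
    intro t ht
    have h1 : (t ^ 2) ^ (1 / 2 : ℝ) = t := by rw [← Real.sqrt_eq_rpow, Real.sqrt_sq ht.le]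
    have h2 : (t ^ 2 * lam) ^ (k / 2 - 1) = t ^ (k - 2) * lam ^ (k / 2 - 1) := by
      rw [Real.mul_rpow (by positivity) hlam0.le, ← Real.rpow_two, ← Real.rpow_mul ht.le]
      congr 2; ring
    rw [momentConstAt, h1, h2, hφ, mul_div_assoc t]
  have hderiv : ∀ t, 0 < t → HasDerivAt φ
      (D * (-((t * (L / 2)) ^ (k - 1) * Real.exp (-(t * (L / 2)))) * (L / 2)) +
        k * (((k - 2) * t ^ (k - 2 - 1)) * lam ^ (k / 2 - 1)) / (k - 2)) t := by
    intro t ht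
    have h1 : HasDerivAt (fun t => upperGamma k (t * (L / 2)))
        (-((t * (L / 2)) ^ (k - 1) * Real.exp (-(t * (L / 2)))) * (L / 2)) t :=
      HasDerivAt.comp (h₂ := upperGamma k) t
        (hasDerivAt_upperGamma hk0 (by positivity)) (hasDerivAt_mul_const (L / 2))
    exact (h1.const_mul D).add ((((Real.hasDerivAt_rpow_const (Or.inl ht.ne')).mul_const
      _).const_mul k).sub_const 2 |>.div_const _)
  have hneg : ∀ t ∈ Ioo 1 (4 / L), deriv φ t < 0 := by
    rintro t ⟨ht1, htT⟩
    have ht0 : 0 < t := by linarith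
    rw [(hderiv t ht0).deriv]
    -- This is the condition φ' < 0 after taking logarithms; log t ≥ 1 - 1/t gives it exactly on 1 <
    -- t < 4/L.
    have hlog : (t - 1) * (L / 2) < 2 * Real.log t := by
      have h1 := Real.one_sub_inv_le_log_of_pos ht0
      have h2 : (t - 1) * (L / 2) < 2 * (1 - t⁻¹) := by
        rw [lt_div_iff₀ hL0] at htT
        have h3 : 2 * (1 - t⁻¹) - (t - 1) * (L / 2) = (t - 1) * (4 - t * L) / (2 * t) := by
          field_simp
          ring
        have h4 : 0 < (t - 1) * (4 - t * L) / (2 * t) :=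
          div_pos (mul_pos (by linarith) (by linarith)) (by linarith)
        linarith
      linarith
    have hDL : D * ((t * (L / 2)) ^ (k - 1) * Real.exp (-(t * (L / 2))) * (L / 2)) =
        k * lam ^ (k / 2 - 1) * t ^ (k - 1) * Real.exp (-((t - 1) * (L / 2))) := by
      have h1 : √(lam - 1) = Real.exp (L / 2) := by
        rw [Real.exp_half, hLdef, Real.exp_log (by linarith)]
      have h2 : (2 * √lam / L) ^ k * (L / 2) ^ (k - 1) * (L / 2) = lam ^ (k / 2 - 1) * lam := by
        rw [mul_assoc, ← Real.rpow_add_one (by positivity), sub_add_cancel,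
          ← Real.mul_rpow (by positivity) (by positivity), ← Real.rpow_add_one hlam0.ne',
          sub_add_cancel, show 2 * √lam / L * (L / 2) = √lam by field_simp, Real.sqrt_eq_rpow,
          ← Real.rpow_mul hlam0.le]
        congr 1; ring
      have h3 : Real.exp (-((t - 1) * (L / 2))) = Real.exp (L / 2) * Real.exp (-(t * (L / 2))) := by
        rw [← Real.exp_add]; congr 1; ring
      rw [hD, h1, h3, Real.mul_rpow ht0.le (by positivity)]
      calc _ = ((2 * √lam / L) ^ k * (L / 2) ^ (k - 1) * (L / 2)) / lam *
            (k * t ^ (k - 1) * (Real.exp (L / 2) * Real.exp (-(t * (L / 2))))) := by ring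
        _ = _ := by rw [h2]; field_simp
    have hexp : t ^ (k - 3) < t ^ (k - 1) * Real.exp (-((t - 1) * (L / 2))) := by
      rw [Real.rpow_def_of_pos ht0, Real.rpow_def_of_pos ht0, ← Real.exp_add, Real.exp_lt_exp]
      nlinarith
    have hpos : 0 < k * lam ^ (k / 2 - 1) := by positivity
    have h5 : k * (((k - 2) * t ^ (k - 2 - 1)) * lam ^ (k / 2 - 1)) / (k - 2) =
        k * lam ^ (k / 2 - 1) * t ^ (k - 3) := by
      rw [show k - 2 - 1 = k - 3 by ring]
      have : k - 2 ≠ 0 := by linarith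
      field_simp
    have h6 := mul_lt_mul_of_pos_left hexp hpos
    rw [h5, neg_mul, mul_neg, hDL]
    linarith
  have hanti : StrictAntiOn φ (Icc 1 (4 / L)) :=
    strictAntiOn_of_deriv_neg (convex_Icc _ _)
      (fun t ht => (hderiv t (by linarith [ht.1])).continuousAt.continuousWithinAt)
      (by rw [interior_Icc]; exact hneg)
  refine ⟨(4 / L) ^ 2, one_lt_pow₀ hT two_ne_zero, ?_⟩
  have h1 := hφeq 1 one_pos
  rw [one_pow] at h1
  rw [hφeq _ (by linarith), h1]
  exact hanti (left_mem_Icc.2 hT.le) (right_mem_Icc.2 hT.le) hT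

/-- For large `lam`, decreasing `lam` with `gam * lam` fixed decreases the constant. -/
theorem exists_momentConstAt_lt_of_le_log (hk : 2 < k) {lam : ℝ} (hlam : 2 < lam)
    (hL : 4 ≤ Real.log (lam - 1)) : ∃ lam' gam : ℝ, 2 < lam' ∧ 1 < gam ∧
      momentConstAt k lam' gam < momentConstAt k lam 1 := by
  have hk0 : 0 < k := by linarith
  have hlam0 : 0 < lam := by linarith
  have hs0 : 0 < √lam := Real.sqrt_pos.2 hlam0
  -- Along γ = λ/u the power term is constant, so only ψ varies; a(u) is the tail rate and H(a(u))
  -- the tail integral up to the prefactor.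
  set a : ℝ → ℝ := fun u => Real.log (u - 1) / (2 * √u) with ha
  set H : ℝ → ℝ := fun b => b ^ (-k) * upperGamma k (√lam * b) with hH
  set ψ : ℝ → ℝ := fun u => √(u - 1) / u * H (a u) with hψ
  have hψeq : ∀ u, 2 < u → momentConstAt k u (lam / u) =
      k * ψ u + (k * lam ^ (k / 2 - 1) - 2) / (k - 2) := by
    intro u hu
    have hu0 : 0 < u := by linarith
    have hlog : 0 < Real.log (u - 1) := Real.log_pos (by linarith)
    have hsu : 0 < √u := Real.sqrt_pos.2 hu0
    have h1 : (2 * √u / Real.log (u - 1)) ^ k = a u ^ (-k) := by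
      rw [Real.rpow_neg (by positivity), ← Real.inv_rpow (by positivity), inv_div]
    have h2 : (lam / u) ^ (1 / 2 : ℝ) * Real.log (u - 1) / 2 = √lam * a u := by
      rw [← Real.sqrt_eq_rpow, Real.sqrt_div hlam0.le, ha]
      field_simp
    rw [momentConstAt, h1, h2, div_mul_cancel₀ _ hu0.ne', hψ]
    ring
  set L := Real.log (lam - 1) with hLdef
  set w := √(lam - 1) with hw
  have hlam1 : 0 < lam - 1 := by linarith
  have hw0 : 0 < w := Real.sqrt_pos.2 hlam1
  have hw2 : w ^ 2 = lam - 1 := Real.sq_sqrt hlam1.le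
  have hs2 : √lam ^ 2 = lam := Real.sq_sqrt hlam0.le
  have hL0 : 0 < L := by linarith
  have haval : a lam = L / (2 * √lam) := rfl
  have ha0 : 0 < a lam := by rw [haval]; positivity
  have hda : HasDerivAt a (-((L - 2 * lam / (lam - 1)) / (4 * lam * √lam))) lam := by
    have h1 : HasDerivAt (fun u : ℝ => Real.log (u - 1)) (1 / (lam - 1)) lam :=
      ((hasDerivAt_id lam).sub_const 1).log hlam1.ne'
    have h2 : HasDerivAt (fun u : ℝ => 2 * √u) (2 * (1 / (2 * √lam))) lam :=
      (Real.hasDerivAt_sqrt hlam0.ne').const_mul 2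
    refine (h1.div h2 (by positivity)).congr_deriv ?_
    have : lam - 1 ≠ 0 := hlam1.ne'
    rw [mul_pow, hs2, ← hLdef]
    field_simp
    rw [hs2]
    ring
  have hdC : HasDerivAt (fun u : ℝ => √(u - 1) / u) (-((w ^ 2 - 1) / (2 * w * lam ^ 2))) lam := by
    have h1 : HasDerivAt (fun u : ℝ => √(u - 1)) (1 / (2 * w)) lam :=
      ((hasDerivAt_id lam).sub_const 1).sqrt hlam1.ne'
    refine (h1.div (hasDerivAt_id lam) hlam0.ne').congr_deriv ?_
    have h3 : lam = w ^ 2 + 1 := by linarith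
    rw [← hw]
    simp only [id]
    field_simp
    rw [h3]
    ring
  set x := √lam * a lam with hx
  have hx0 : 0 < x := by positivity
  have hdH : HasDerivAt H (-(a lam ^ (-k) / a lam * upperGamma (k + 1) x)) (a lam) := by
    have h1 : HasDerivAt (fun b => upperGamma k (√lam * b))
        (-(x ^ (k - 1) * Real.exp (-x)) * √lam) (a lam) :=
      HasDerivAt.comp (h₂ := upperGamma k) (a lam)
        (hasDerivAt_upperGamma hk0 hx0) (hasDerivAt_const_mul (√lam))
    refine ((Real.hasDerivAt_rpow_const (p := -k) (Or.inl ha0.ne')).mul h1).congr_deriv ?_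
    have h2 : a lam ^ (-k - 1) = a lam ^ (-k) / a lam := Real.rpow_sub_one ha0.ne' _
    have h3 : x ^ k = x ^ (k - 1) * x := by
      rw [← Real.rpow_add_one hx0.ne', sub_add_cancel]
    rw [upperGamma_add_one hk0 hx0, h2, h3]
    have h4 : √lam = x / a lam := by rw [hx]; field_simp
    rw [h4, show x / a lam * a lam = x by field_simp]
    ring
  have hdψ := hdC.mul (HasDerivAt.comp lam hdH hda)
  set B := (L - 2 * lam / (lam - 1)) / (4 * lam) with hB
  have hL2 : 2 * lam / (lam - 1) < 4 := by rw [div_lt_iff₀ hlam1]; linarith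
  have hB0 : 0 < B := div_pos (by linarith) (by linarith)
  have hHpos : 0 < H (a lam) := mul_pos (Real.rpow_pos_of_pos ha0 _) (upperGamma_pos hk0 hx0.le)
  -- Claim ψ'(λ) > 0: the prefactor decreases in u, but the rate a also decreases, and the resulting
  -- growth of H outweighs it.
  have hpos : 0 < -((w ^ 2 - 1) / (2 * w * lam ^ 2)) * H (a lam) + w / lam *
      (-(a lam ^ (-k) / a lam * upperGamma (k + 1) x) *
        -((L - 2 * lam / (lam - 1)) / (4 * lam * √lam))) := by
    have h1 : H (a lam) * B < a lam ^ (-k) / a lam * upperGamma (k + 1) x *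
        ((L - 2 * lam / (lam - 1)) / (4 * lam * √lam)) := by
      have h2 : (L - 2 * lam / (lam - 1)) / (4 * lam * √lam) = B / √lam := by
        rw [hB, div_div]
      have h3 : H (a lam) * B = a lam ^ (-k) / a lam * (x * upperGamma k x) * (B / √lam) := by
        change a lam ^ (-k) * upperGamma k x * B = _
        rw [hx]
        field_simp
      rw [h2, h3]
      have := mul_upperGamma_lt hk0 hx0
      gcongr
    -- Equality holds at L = 4, which is why that threshold suffices here; the strict inequality
    -- comes from `h1`.
    have h4 : (w ^ 2 - 1) / (2 * w * lam ^ 2) ≤ w / lam * B := by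
      have h5 : (4 - 2 * lam / (lam - 1)) / (4 * lam) ≤ B := by rw [hB]; gcongr
      refine le_trans (le_of_eq ?_) (mul_le_mul_of_nonneg_left h5 (by positivity))
      have h6 : lam = w ^ 2 + 1 := by linarith
      rw [← hw2, h6]
      field_simp
      ring
    have h7 := mul_lt_mul_of_pos_left h1 (div_pos hw0 hlam0)
    have h8 := mul_le_mul_of_nonneg_right h4 hHpos.le
    have h9 : w / lam * (H (a lam) * B) = w / lam * B * H (a lam) := by ring
    rw [neg_mul_neg]
    linarith
  obtain ⟨u, hu2, hulam, hlt⟩ := exists_lt_of_hasDerivAt_pos (f := ψ) hdψ hpos hlam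
  refine ⟨u, lam / u, hu2, (one_lt_div (by linarith)).2 hulam, ?_⟩
  have h1 := hψeq lam hlam
  rw [div_self hlam0.ne'] at h1
  rw [hψeq u hu2, h1]
  gcongr

/-- The domain γ > 1 is open, so compactness gives a minimiser only with γ ≥ 1; the two descent
lemmas exclude γ = 1. -/
theorem isLeast_momentConst (hk : 2 < k) : IsLeast (momentConstValues k) (momentConst k) := by
  obtain ⟨lam, gam, hlam, hgam, hmin⟩ := exists_isMin_momentConstAt hk
  have hgam1 : 1 < gam := by
    refine hgam.lt_of_ne fun h => ?_
    subst h
    rcases lt_or_ge (Real.log (lam - 1)) 4 with hL | hL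
    · obtain ⟨g, hg, hlt⟩ := exists_momentConstAt_lt_of_log_lt hk hlam hL
      exact (hmin lam g hlam hg.le).not_gt hlt
    · obtain ⟨l, g, hl, hg, hlt⟩ := exists_momentConstAt_lt_of_le_log hk hlam hL
      exact (hmin l g hl hg.le).not_gt hlt
  have hleast : IsLeast (momentConstValues k) (momentConstAt k lam gam) := by
    refine ⟨⟨lam, gam, hlam, hgam1, rfl⟩, ?_⟩
    rintro _ ⟨l, g, hl, hg, rfl⟩
    exact hmin l g hl hg.le
  rw [momentConst, hleast.csInf_eq]
  exact hleast

end Minimum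

end

theorem mainTheorem9 :
    -- the constant `A_k` is a genuine (attained) minimum
    (∀ k : ℝ, 2 < k → IsLeast (momentConstValues k) (momentConst k)) ∧
    -- the moment inequality; the moments involved are finite
    (∀ (p : ℕ) (π : EuclideanSpace ℝ (Fin p) → ℝ), IsProbDensity π → IsLogConcave π →
      ∀ k : ℝ, 2 < k →
        Integrable (fun x => ‖x‖ ^ (2 : ℝ)) (law π) ∧
        Integrable (fun x => ‖x‖ ^ k) (law π) ∧
        moment π k ≤ momentConst k * moment π 2 ^ (k / 2)) ∧
    -- the numerical values
    momentConst 3 ≤ 40.40 ∧ momentConst 4 ≤ 441.43 := by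
  refine ⟨fun k hk => isLeast_momentConst hk, fun p π hπ h k hk => ⟨?_, ?_, ?_⟩, ?_, ?_⟩
  · exact h.integrable_norm_rpow hπ two_pos
  · exact h.integrable_norm_rpow hπ (by linarith)
  · obtain ⟨lam, gam, hlam, hgam, heq⟩ := (isLeast_momentConst hk).1
    rw [heq]
    exact h.moment_le hπ hk hlam hgam
  · refine ((isLeast_momentConst (by norm_num)).2 ⟨_, _, ?_, ?_, rfl⟩).trans momentConstAt_three_le
    · linarith [Real.add_one_le_exp (2.7 : ℝ)]
    · norm_num
  · refine ((isLeast_momentConst (by norm_num)).2 ⟨_, _, ?_, ?_, rfl⟩).trans momentConstAt_four_le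
    · linarith [Real.add_one_le_exp (2.64 : ℝ)]
    · norm_num
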